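/- All manifolds, metrics, tensor fields and maps are smooth and finite-dimensional, and manifolds have no boundary. On a Riemannian manifold, $\nabla$ is the Levi-Civita connection, $R(X,Y)Z=\nabla_X\nabla_YZ-\nabla_Y\nabla_XZ-\nabla_{[X,Y]}Z$, and for a local orthonormal frame $\{e_i\}$ and a vector field $V$ put $\operatorname{tr}\nabla^2V=\sum_i(\nabla_{e_i}\nabla_{e_i}V-\nabla_{\nabla_{e_i}e_i}V)$, $\operatorname{Ric}V=\sum_iR(V,e_i)e_i$ and $\operatorname{div}V=\sum_i g(\nabla_{e_i}V,e_i)$. Let $(M,g,J)$ be a locally conformal Kähler manifold of real dimension $m$, i.e. a Hermitian manifold ($J$ is an integrable almost complex structure and $g(JX,JY)=g(X,Y)$) in which every point has a neighbourhood on which $g$ is conformal to a Kähler metric. Let $\Omega(X,Y)=g(X,JY)$, let $\theta$ be its Lee form, i.e. a closed one-form with $d\Omega=\theta\wedge\Omega$, and let $B$ be the Lee vector field, i.e. the vector field with $g(B,\cdot)=\theta$. Suppose that $$g(\nabla_XB,Y)-g(\nabla_{JX}B,JY)=\tfrac{2-m}{4}\big(\theta(X)\theta(Y)-\theta(JX)\theta(JY)\big)$$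 for all tangent vectors $X,Y$ at any point of $M$, and that $$\operatorname{tr}\nabla^2B+\operatorname{Ric}B+\tfrac{m-6}{2}\nabla_BB+\Big(\operatorname{div}B-\tfrac{m-2}{4}|B|^2\Big)B=0.$$ Then every holomorphic map $\varphi$ (i.e. $d\varphi\circ J=J^N\circ d\varphi$) from $(M,J,g)$ into an almost Hermitian manifold $(N,J^N,h)$ that is $(1,2)$-symplectic, i.e. $(\nabla_XJ^N)Y+(\nabla_{J^NX}J^N)(J^NY)=0$ for all $X,Y$, is biharmonic. Here $\varphi$ is biharmonic if its bitension field vanishes: $$\tau_2(\varphi)=\sum_i\Big(\nabla^\varphi_{e_i}\nabla^\varphi_{e_i}\tau-\nabla^\varphi_{\nabla_{e_i}e_i}\tau+R^N(\tau,d\varphi(e_i))\,d\varphi(e_i)\Big)=0,$$ where $\nabla^\varphi$ is the pull-back connection on $\varphi^{-1}TN$ and $\tau=\tau(\varphi)=\operatorname{tr}\nabla d\varphi$ is the tension field of $\varphi$. -/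

import Mathlib

open Bundle
open scoped Manifold ContDiff

noncomputable section

/-! ### Riemannian geometry in coordinates

`G`, `H` are the coordinate expressions of Riemannian metrics on open subsets of the
finite-dimensional spaces `E`, `F`; `Jl` is the coordinate expression of an almost complex
structure. A constant vector `a : E` stands for the coordinate vector field with constant
coefficients `a`. -/

namespace Coord

variable {E : Type*} [NormedAddCommGroup E] [NormedSpace ℝ E]
  {F : Type*} [NormedAddCommGroup F] [NormedSpace ℝ F]

/-- The Christoffel symbols of the Levi-Civita connection: `Γ_u(v, w) = ∇_v w` is the vector
with `2 G(Γ(v, w), z) = (∂_v G)(w, z) + (∂_w G)(v, z) - (∂_z G)(v, w)` for all `z`. -/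
def christoffel (G : E → E →L[ℝ] E →L[ℝ] ℝ) (u v w : E) : E :=
  (G u).inverse ((1 / 2 : ℝ) •
    (fderiv ℝ G u v w + fderiv ℝ G u w v - ((fderiv ℝ G u).flip v).flip w))

/-- The Levi-Civita covariant derivative `∇_a V` of a vector field `V`. -/
def cov (G : E → E →L[ℝ] E →L[ℝ] ℝ) (V : E → E) (u a : E) : E :=
  fderiv ℝ V u a + christoffel G u a (V u)

/-- The covariant derivative `∇^f_a Ψ` of a vector field `Ψ` along the map `f`, i.e. the pull-back
by `f` of the Levi-Civita connection of the target metric `H`. -/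
def covAlong (H : F → F →L[ℝ] F →L[ℝ] ℝ) (f : E → F) (Ψ : E → F) (u a : E) : F :=
  fderiv ℝ Ψ u a + christoffel H (f u) (fderiv ℝ f u a) (Ψ u)

/-- The curvature `R(a, b)c = ∇_a ∇_b c - ∇_b ∇_a c` (coordinate fields commute). -/
def curv (G : E → E →L[ℝ] E →L[ℝ] ℝ) (u a b c : E) : E :=
  cov G (fun y => christoffel G y b c) u a - cov G (fun y => christoffel G y a c) u b

/-- `(∇_a J) b = ∇_a (J b) - J (∇_a b)`. -/
def nablaJ (G : E → E →L[ℝ] E →L[ℝ] ℝ) (Jl : E → E →L[ℝ] E) (u a b : E) : E :=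
  cov G (fun y => Jl y b) u a - Jl u (christoffel G u a b)

/-- The second fundamental form
`∇df(a, b) = ∇^f_a (df b) - df(∇_a b)` of `f : (E, G) → (F, H)`. -/
def secondFundForm (G : E → E →L[ℝ] E →L[ℝ] ℝ) (H : F → F →L[ℝ] F →L[ℝ] ℝ) (f : E → F)
    (u a b : E) : F :=
  covAlong H f (fun y => fderiv ℝ f y b) u a - fderiv ℝ f u (christoffel G u a b)

/-- The Nijenhuis tensor `[Ja, Jb] - J[Ja, b] - J[a, Jb] - [a, b]` on coordinate fields. -/
def nijenhuis (Jl : E → E →L[ℝ] E) (u a b : E) : E :=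
  VectorField.lieBracket ℝ (fun y => Jl y a) (fun y => Jl y b) u
    - Jl u (VectorField.lieBracket ℝ (fun y => Jl y a) (fun _ => b) u)
    - Jl u (VectorField.lieBracket ℝ (fun _ => a) (fun y => Jl y b) u)
    - VectorField.lieBracket ℝ (fun _ : E => a) (fun _ => b) u

/-- The exterior derivative of a one-form. -/
def dOne (θ : E → E →L[ℝ] ℝ) (u a b : E) : ℝ :=
  fderiv ℝ θ u a b - fderiv ℝ θ u b a

/-- The exterior derivative of a two-form. -/
def dTwo (η : E → E →L[ℝ] E →L[ℝ] ℝ) (u a b c : E) : ℝ :=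
  fderiv ℝ η u a b c - fderiv ℝ η u b a c + fderiv ℝ η u c a b

/-- The wedge product `θ ∧ η` of a one-form and a two-form at a point. -/
def wedgeOneTwo (θ : E →L[ℝ] ℝ) (η : E →L[ℝ] E →L[ℝ] ℝ) (a b c : E) : ℝ :=
  θ a * η b c - θ b * η a c + θ c * η a b

variable [FiniteDimensional ℝ E]

/-- The trace `∑ g^{ij} T(b_i, b_j)` of a bilinear expression `T` with respect to the inner product
`g`; the vector `∑_j g^{ij} b_j` is the `g`-dual of the `i`-th coordinate form. For a `g`-orthonormal
basis `e` it is `∑ T(e_i, e_i)`. -/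
def metricTrace (g : E →L[ℝ] E →L[ℝ] ℝ) (T : E → E → F) : F :=
  ∑ i, T (Module.finBasis ℝ E i)
    (g.inverse (LinearMap.toContinuousLinearMap ((Module.finBasis ℝ E).coord i)))

/-- The tension field `τ(f) = tr ∇df`. -/
def tension (G : E → E →L[ℝ] E →L[ℝ] ℝ) (H : F → F →L[ℝ] F →L[ℝ] ℝ) (f : E → F) (u : E) : F :=
  metricTrace (G u) (secondFundForm G H f u)

/-- The rough Laplacian `tr (∇^f)² Ψ = ∑ ∇^f_{e_i} ∇^f_{e_i} Ψ - ∇^f_{∇_{e_i} e_i} Ψ` of a vector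
field `Ψ` along `f`. -/
def roughLaplacianAlong (G : E → E →L[ℝ] E →L[ℝ] ℝ) (H : F → F →L[ℝ] F →L[ℝ] ℝ) (f : E → F)
    (Ψ : E → F) (u : E) : F :=
  metricTrace (G u) fun a b =>
    covAlong H f (fun y => covAlong H f Ψ y b) u a - covAlong H f Ψ u (christoffel G u a b)

/-- `Ric^f v = ∑ R^H(v, df e_i) (df e_i)`. -/
def ricciAlong (G : E → E →L[ℝ] E →L[ℝ] ℝ) (H : F → F →L[ℝ] F →L[ℝ] ℝ) (f : E → F)
    (u : E) (v : F) : F :=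
  metricTrace (G u) fun a b => curv H (f u) v (fderiv ℝ f u a) (fderiv ℝ f u b)

/-- The bitension field `τ₂(f) = (tr (∇^f)² + Ric^f)(τ(f))`. -/
def bitension (G : E → E →L[ℝ] E →L[ℝ] ℝ) (H : F → F →L[ℝ] F →L[ℝ] ℝ) (f : E → F) (u : E) : F :=
  roughLaplacianAlong G H f (tension G H f) u + ricciAlong G H f u (tension G H f u)

/-- The rough Laplacian `tr ∇² V = ∑ ∇_{e_i} ∇_{e_i} V - ∇_{∇_{e_i} e_i} V` of a vector field. -/
def roughLaplacian (G : E → E →L[ℝ] E →L[ℝ] ℝ) (V : E → E) (u : E) : E :=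
  metricTrace (G u) fun a b =>
    cov G (fun y => cov G V y b) u a - cov G V u (christoffel G u a b)

/-- The Ricci operator `Ric v = ∑ R(v, e_i) e_i`. -/
def ricci (G : E → E →L[ℝ] E →L[ℝ] ℝ) (u v : E) : E :=
  metricTrace (G u) fun a b => curv G u v a b

/-- The divergence `div V = ∑ G(∇_{e_i} V, e_i)`. -/
def divergence (G : E → E →L[ℝ] E →L[ℝ] ℝ) (V : E → E) (u : E) : ℝ :=
  metricTrace (G u) fun a b => G u (cov G V u a) b

end Coord

/-! ### Almost Hermitian manifolds -/

namespace AH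

variable {E : Type*} [NormedAddCommGroup E] [NormedSpace ℝ E]
  {M : Type*} [TopologicalSpace M] [ChartedSpace E M]
  {F : Type*} [NormedAddCommGroup F] [NormedSpace ℝ F]
  {N : Type*} [TopologicalSpace N] [ChartedSpace F N]

/-- The differential at `x` of the preferred chart at `p`. -/
def chartDiff (p x : M) : TangentSpace 𝓘(ℝ, E) x →L[ℝ] E :=
  mfderiv 𝓘(ℝ, E) 𝓘(ℝ, E) (extChartAt 𝓘(ℝ, E) p) x

/-- The inverse of `chartDiff p x`: it sends the components of a tangent vector in the chart at `p`
to the vector. -/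
def chartFrame (p x : M) : E →L[ℝ] TangentSpace 𝓘(ℝ, E) x :=
  (chartDiff p x).inverse

/-- Coordinate expression, in the chart at `p`, of a covariant two-tensor. -/
def locBilin (p : M)
    (b : ∀ x : M, TangentSpace 𝓘(ℝ, E) x →L[ℝ] TangentSpace 𝓘(ℝ, E) x →L[ℝ] ℝ)
    (u : E) : E →L[ℝ] E →L[ℝ] ℝ :=
  let x := (extChartAt 𝓘(ℝ, E) p).symm u
  ((ContinuousLinearMap.precomp ℝ (chartFrame p x)).comp (b x)).comp (chartFrame p x)

/-- Coordinate expression, in the chart at `p`, of a one-form. -/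
def locForm (p : M) (θ : ∀ x : M, TangentSpace 𝓘(ℝ, E) x →L[ℝ] ℝ) (u : E) : E →L[ℝ] ℝ :=
  let x := (extChartAt 𝓘(ℝ, E) p).symm u
  (θ x).comp (chartFrame p x)

/-- Coordinate expression, in the chart at `p`, of a field of endomorphisms. -/
def locEndo (p : M) (J : ∀ x : M, TangentSpace 𝓘(ℝ, E) x →L[ℝ] TangentSpace 𝓘(ℝ, E) x)
    (u : E) : E →L[ℝ] E :=
  let x := (extChartAt 𝓘(ℝ, E) p).symm u
  ((chartDiff p x).comp (J x)).comp (chartFrame p x)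

/-- Coordinate expression, in the chart at `p`, of a vector field. -/
def locVec (p : M) (V : ∀ x : M, TangentSpace 𝓘(ℝ, E) x) (u : E) : E :=
  let x := (extChartAt 𝓘(ℝ, E) p).symm u
  chartDiff p x (V x)

/-- Coordinate expression of a map, in the charts at `p` and `φ p`. -/
def locMap (φ : M → N) (p : M) (u : E) : F :=
  extChartAt 𝓘(ℝ, F) (φ p) (φ ((extChartAt 𝓘(ℝ, E) p).symm u))

/-- `b(·, J ·)`; for `b = g` the fundamental form `Ω(X, Y) = g(X, JY)`. -/
def fundForm (b : ∀ x : M, TangentSpace 𝓘(ℝ, E) x →L[ℝ] TangentSpace 𝓘(ℝ, E) x →L[ℝ] ℝ)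
    (J : ∀ x : M, TangentSpace 𝓘(ℝ, E) x →L[ℝ] TangentSpace 𝓘(ℝ, E) x) (x : M) :
    TangentSpace 𝓘(ℝ, E) x →L[ℝ] TangentSpace 𝓘(ℝ, E) x →L[ℝ] ℝ :=
  (ContinuousLinearMap.precomp ℝ (J x)).comp (b x)

variable [IsManifold 𝓘(ℝ, E) ∞ M] [IsManifold 𝓘(ℝ, F) ∞ N]

/-- `(M, J, g)` is an almost Hermitian manifold. -/
structure IsAlmostHermitian
    (g : ContMDiffRiemannianMetric 𝓘(ℝ, E) ∞ E (TangentSpace 𝓘(ℝ, E) : M → Type _))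
    (J : ∀ x : M, TangentSpace 𝓘(ℝ, E) x →L[ℝ] TangentSpace 𝓘(ℝ, E) x) : Prop where
  smooth : ContMDiff 𝓘(ℝ, E) (𝓘(ℝ, E).prod 𝓘(ℝ, E →L[ℝ] E)) ∞
    (fun x => TotalSpace.mk' (E →L[ℝ] E)
      (E := fun x : M => TangentSpace 𝓘(ℝ, E) x →L[ℝ] TangentSpace 𝓘(ℝ, E) x) x (J x))
  sq_eq_neg : ∀ (x : M) (v : TangentSpace 𝓘(ℝ, E) x), J x (J x v) = -v
  isometry : ∀ (x : M) (v w : TangentSpace 𝓘(ℝ, E) x), g.inner x (J x v) (J x w) = g.inner x v w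

/-- `(M, J, g)` is a Hermitian manifold: almost Hermitian with `J` integrable, i.e. with vanishing
Nijenhuis tensor. -/
structure IsHermitian
    (g : ContMDiffRiemannianMetric 𝓘(ℝ, E) ∞ E (TangentSpace 𝓘(ℝ, E) : M → Type _))
    (J : ∀ x : M, TangentSpace 𝓘(ℝ, E) x →L[ℝ] TangentSpace 𝓘(ℝ, E) x) : Prop
    extends IsAlmostHermitian g J where
  integrable : ∀ p : M, ∀ u ∈ (extChartAt 𝓘(ℝ, E) p).target, ∀ a b : E,
    Coord.nijenhuis (locEndo p J) u a b = 0

/-- `(M, J, g)` is locally conformally Kähler: Hermitian, and near every point there is a smooth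
`γ` such that the metric `e^{-2γ} g`, which is Hermitian as well, is Kähler, i.e. has a closed
fundamental form. -/
structure IsLCK
    (g : ContMDiffRiemannianMetric 𝓘(ℝ, E) ∞ E (TangentSpace 𝓘(ℝ, E) : M → Type _))
    (J : ∀ x : M, TangentSpace 𝓘(ℝ, E) x →L[ℝ] TangentSpace 𝓘(ℝ, E) x) : Prop
    extends IsHermitian g J where
  locConfKahler : ∀ x : M, ∃ U : Set M, IsOpen U ∧ x ∈ U ∧ ∃ γ : M → ℝ,
    ContMDiffOn 𝓘(ℝ, E) 𝓘(ℝ, ℝ) ∞ γ U ∧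
    ∀ p : M, ∀ u ∈ (extChartAt 𝓘(ℝ, E) p).target, (extChartAt 𝓘(ℝ, E) p).symm u ∈ U →
      ∀ a b c : E,
        Coord.dTwo (locBilin p (fundForm (fun y => Real.exp (-2 * γ y) • g.inner y) J)) u a b c = 0

/-- `θ` is a Lee form of `(M, J, g)`: a smooth closed one-form with `dΩ = θ ∧ Ω`. -/
structure IsLeeForm
    (g : ContMDiffRiemannianMetric 𝓘(ℝ, E) ∞ E (TangentSpace 𝓘(ℝ, E) : M → Type _))
    (J : ∀ x : M, TangentSpace 𝓘(ℝ, E) x →L[ℝ] TangentSpace 𝓘(ℝ, E) x)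
    (θ : ∀ x : M, TangentSpace 𝓘(ℝ, E) x →L[ℝ] ℝ) : Prop where
  smooth : ContMDiff 𝓘(ℝ, E) (𝓘(ℝ, E).prod 𝓘(ℝ, E →L[ℝ] ℝ)) ∞
    (fun x => TotalSpace.mk' (E →L[ℝ] ℝ)
      (E := fun x : M => TangentSpace 𝓘(ℝ, E) x →L[ℝ] Trivial M ℝ x) x (θ x))
  closed : ∀ p : M, ∀ u ∈ (extChartAt 𝓘(ℝ, E) p).target, ∀ a b : E,
    Coord.dOne (locForm p θ) u a b = 0
  dOmega : ∀ p : M, ∀ u ∈ (extChartAt 𝓘(ℝ, E) p).target, ∀ a b c : E,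
    Coord.dTwo (locBilin p (fundForm g.inner J)) u a b c =
      Coord.wedgeOneTwo (locForm p θ u) (locBilin p (fundForm g.inner J) u) a b c

/-- `(M, J, g)` is a `(1,2)`-symplectic (quasi-Kähler) almost Hermitian manifold:
`(∇_X J) Y + (∇_{JX} J) JY = 0` for all `X`, `Y`. -/
structure IsOneTwoSymplectic
    (g : ContMDiffRiemannianMetric 𝓘(ℝ, E) ∞ E (TangentSpace 𝓘(ℝ, E) : M → Type _))
    (J : ∀ x : M, TangentSpace 𝓘(ℝ, E) x →L[ℝ] TangentSpace 𝓘(ℝ, E) x) : Prop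
    extends IsAlmostHermitian g J where
  quasiKahler : ∀ p : M, ∀ u ∈ (extChartAt 𝓘(ℝ, E) p).target, ∀ a b : E,
    Coord.nablaJ (locBilin p g.inner) (locEndo p J) u a b +
      Coord.nablaJ (locBilin p g.inner) (locEndo p J) u
        (locEndo p J u a) (locEndo p J u b) = 0

/-- `φ : (M, J) → (N, J')` is holomorphic: smooth with `dφ ∘ J = J' ∘ dφ`. -/
structure IsHolomorphic
    (J : ∀ x : M, TangentSpace 𝓘(ℝ, E) x →L[ℝ] TangentSpace 𝓘(ℝ, E) x)
    (J' : ∀ y : N, TangentSpace 𝓘(ℝ, F) y →L[ℝ] TangentSpace 𝓘(ℝ, F) y)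
    (φ : M → N) : Prop where
  smooth : ContMDiff 𝓘(ℝ, E) 𝓘(ℝ, F) ∞ φ
  comm : ∀ (x : M) (v : TangentSpace 𝓘(ℝ, E) x),
    mfderiv 𝓘(ℝ, E) 𝓘(ℝ, F) φ x (J x v) = J' (φ x) (mfderiv 𝓘(ℝ, E) 𝓘(ℝ, F) φ x v)

variable [FiniteDimensional ℝ E]

/-- `∇_v V` at `x`, for the Levi-Civita connection of `g`. -/
def nabla (g : ContMDiffRiemannianMetric 𝓘(ℝ, E) ∞ E (TangentSpace 𝓘(ℝ, E) : M → Type _))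
    (V : ∀ x : M, TangentSpace 𝓘(ℝ, E) x) (x : M) (v : TangentSpace 𝓘(ℝ, E) x) :
    TangentSpace 𝓘(ℝ, E) x :=
  chartFrame x x (Coord.cov (locBilin x g.inner) (locVec x V) (extChartAt 𝓘(ℝ, E) x x)
    (chartDiff x x v))

/-- `tr ∇² V` at `x`. -/
def roughLaplacian
    (g : ContMDiffRiemannianMetric 𝓘(ℝ, E) ∞ E (TangentSpace 𝓘(ℝ, E) : M → Type _))
    (V : ∀ x : M, TangentSpace 𝓘(ℝ, E) x) (x : M) : TangentSpace 𝓘(ℝ, E) x :=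
  chartFrame x x
    (Coord.roughLaplacian (locBilin x g.inner) (locVec x V) (extChartAt 𝓘(ℝ, E) x x))

/-- `Ric v` for `v` tangent at `x`. -/
def ricci (g : ContMDiffRiemannianMetric 𝓘(ℝ, E) ∞ E (TangentSpace 𝓘(ℝ, E) : M → Type _))
    (x : M) (v : TangentSpace 𝓘(ℝ, E) x) : TangentSpace 𝓘(ℝ, E) x :=
  chartFrame x x
    (Coord.ricci (locBilin x g.inner) (extChartAt 𝓘(ℝ, E) x x) (chartDiff x x v))

/-- `div V` at `x`. -/
def divergence (g : ContMDiffRiemannianMetric 𝓘(ℝ, E) ∞ E (TangentSpace 𝓘(ℝ, E) : M → Type _))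
    (V : ∀ x : M, TangentSpace 𝓘(ℝ, E) x) (x : M) : ℝ :=
  Coord.divergence (locBilin x g.inner) (locVec x V) (extChartAt 𝓘(ℝ, E) x x)

/-- The bitension field `τ₂(φ)` of `φ : (M, g) → (N, h)` at `x`. -/
def bitension (g : ContMDiffRiemannianMetric 𝓘(ℝ, E) ∞ E (TangentSpace 𝓘(ℝ, E) : M → Type _))
    (h : ContMDiffRiemannianMetric 𝓘(ℝ, F) ∞ F (TangentSpace 𝓘(ℝ, F) : N → Type _))
    (φ : M → N) (x : M) : TangentSpace 𝓘(ℝ, F) (φ x) :=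
  chartFrame (φ x) (φ x)
    (Coord.bitension (locBilin x g.inner) (locBilin (φ x) h.inner) (locMap φ x)
      (extChartAt 𝓘(ℝ, E) x x))

/-- `φ : (M, g) → (N, h)` is biharmonic: smooth with vanishing bitension field. -/
structure IsBiharmonic
    (g : ContMDiffRiemannianMetric 𝓘(ℝ, E) ∞ E (TangentSpace 𝓘(ℝ, E) : M → Type _))
    (h : ContMDiffRiemannianMetric 𝓘(ℝ, F) ∞ F (TangentSpace 𝓘(ℝ, F) : N → Type _))
    (φ : M → N) : Prop where
  smooth : ContMDiff 𝓘(ℝ, E) 𝓘(ℝ, F) ∞ φ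
  bitension_eq_zero : ∀ x : M, bitension g h φ x = 0

end AH

end

/-! Write `∇df` for the second fundamental form of the map, `c = (m - 2)/2` and `P = ∇B`.
Differentiating `df ∘ J = J' ∘ df` expresses `∇df(a, Jb)` through `∇df(a, b)`, `∇J` and `∇J'`. In
`∇df(a, a) + ∇df(Ja, Ja)` the terms in `∇J'` cancel because the target is (1,2)-symplectic, and `df`
of `-(J(∇_a J)a + (∇_{Ja} J)a)` remains. The equation `dΩ = θ ∧ Ω` evaluates that vector as `|a|²B -
θ(a)a - θ(Ja)Ja` (`sff_diag`, polarised in `sff_add_sff_J`). So the `J`-invariant part of `∇df` lies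
in the image of `df`, and its trace gives `τ = c df(B)` (`tension_eq`).

For every vector field `W`, the Codazzi equation shows that the Jacobi operator sends `df W` to `∇_W
τ + 2 tr ∇df(·, ∇W) + df(tr ∇²W + Ric W)` (`jacobi_fderiv`). The bitension field is `c` times this
expression at `W = B`, where `∇_B τ = c ∇df(B, B) + c df(PB)`.

To compute the middle term put `A = tr ∇df(·, P·)` and `A' = tr ∇df(J·, JP·)`. Closedness of `θ`
makes `P` symmetric, so `metricTrace_sff_add` gives `A + A' = df((div B)B - PB + JPJB)`. The first
hypothesis prescribes `P + JPJ`, and it yields `A - A' = -c ∇df(B, B)`, since `∇df(JB, JB) = -∇df(B,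
B)`. Adding the two, the terms `∇df(B, B)` cancel from the Jacobi operator. What is left is `df` of
the left side of the second hypothesis, hence zero (`bitension_eq_zero`). The computation takes
place in one pair of charts. -/

section

set_option maxSynthPendingDepth 3
set_option linter.unusedSectionVars false

namespace Coord

variable {E : Type*} [NormedAddCommGroup E] [NormedSpace ℝ E]
  {F : Type*} [NormedAddCommGroup F] [NormedSpace ℝ F]

/-- `G` is a smooth Riemannian metric on the open set `U`. -/
structure IsMetricOn (G : E → E →L[ℝ] E →L[ℝ] ℝ) (U : Set E) : Prop where
  isOpen : IsOpen U
  smooth : ContDiffOn ℝ ∞ G U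
  symm : ∀ u ∈ U, ∀ v w : E, G u v w = G u w v
  pos : ∀ u ∈ U, ∀ v : E, v ≠ 0 → 0 < G u v v

/-! ### Christoffel symbols and the Levi-Civita connection in coordinates. -/

section Christoffel

lemma christoffel_add_left (G : E → E →L[ℝ] E →L[ℝ] ℝ) (u v v' w : E) :
    christoffel G u (v + v') w = christoffel G u v w + christoffel G u v' w := by
  unfold christoffel
  rw [← map_add, ← smul_add]
  congr 2
  ext z
  simp
  ring

lemma christoffel_smul_left (G : E → E →L[ℝ] E →L[ℝ] ℝ) (c : ℝ) (u v w : E) :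
    christoffel G u (c • v) w = c • christoffel G u v w := by
  unfold christoffel
  rw [← map_smul, smul_comm c]
  congr 2
  ext z
  simp
  ring

lemma christoffel_add_right (G : E → E →L[ℝ] E →L[ℝ] ℝ) (u v w w' : E) :
    christoffel G u v (w + w') = christoffel G u v w + christoffel G u v w' := by
  unfold christoffel
  rw [← map_add, ← smul_add]
  congr 2
  ext z
  simp
  ring

lemma christoffel_smul_right (G : E → E →L[ℝ] E →L[ℝ] ℝ) (c : ℝ) (u v w : E) :
    christoffel G u v (c • w) = c • christoffel G u v w := by
  unfold christoffel
  rw [← map_smul, smul_comm c]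
  congr 2
  ext z
  simp
  ring

variable [FiniteDimensional ℝ E]

/-- The bilinear map `(v, w) ↦ B v w` on a finite-dimensional space. -/
noncomputable def mkBilin (B : E → E → F) (h₁ : ∀ v v' w, B (v + v') w = B v w + B v' w)
    (h₂ : ∀ (c : ℝ) v w, B (c • v) w = c • B v w) (h₃ : ∀ v w w', B v (w + w') = B v w + B v w')
    (h₄ : ∀ (c : ℝ) v w, B v (c • w) = c • B v w) : E →L[ℝ] E →L[ℝ] F :=
  LinearMap.toContinuousLinearMap
    ((LinearMap.toContinuousLinearMap (𝕜 := ℝ) (E := E) (F' := F)).toLinearMap ∘ₗ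
      LinearMap.mk₂ ℝ B h₁ h₂ h₃ h₄)

/-- The Christoffel symbols as a bilinear map. -/
noncomputable def chris (G : E → E →L[ℝ] E →L[ℝ] ℝ) (u : E) : E →L[ℝ] E →L[ℝ] E :=
  mkBilin (christoffel G u) (christoffel_add_left G u) (fun c => christoffel_smul_left G c u)
    (christoffel_add_right G u) (fun c => christoffel_smul_right G c u)

lemma chris_apply (G : E → E →L[ℝ] E →L[ℝ] ℝ) (u v w : E) :
    chris G u v w = christoffel G u v w := rfl

variable {G : E → E →L[ℝ] E →L[ℝ] ℝ} {U : Set E} {u : E}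

namespace IsMetricOn

/-- Positivity makes `G u` injective, and `E` has the dimension of its dual. Since `inverse` is a
total operation with a junk value, every use of it in raising an index rests on this. -/
lemma isInvertible (hG : IsMetricOn G U) (hu : u ∈ U) : (G u).IsInvertible := by
  have hinj : Function.Injective (G u).toLinearMap := by
    rw [← LinearMap.ker_eq_bot, LinearMap.ker_eq_bot']
    intro v hv
    by_contra hne
    have := hG.pos u hu v hne
    have h0 : G u v = 0 := hv
    simp [h0] at this
  have hdim : Module.finrank ℝ E = Module.finrank ℝ (E →L[ℝ] ℝ) := by
    rw [← (LinearMap.toContinuousLinearMap (𝕜 := ℝ) (E := E) (F' := ℝ)).finrank_eq]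
    exact (Subspace.dual_finrank_eq).symm
  exact ⟨(LinearEquiv.ofInjectiveOfFinrankEq (G u).toLinearMap hinj hdim).toContinuousLinearEquiv,
    by ext; rfl⟩

lemma apply_inverse (hG : IsMetricOn G U) (hu : u ∈ U) (α : E →L[ℝ] ℝ) :
    G u ((G u).inverse α) = α :=
  ((hG.isInvertible hu).inverse_apply_eq.1 rfl).symm

lemma ext_inner (hG : IsMetricOn G U) (hu : u ∈ U) {v w : E} (h : ∀ z, G u v z = G u w z) :
    v = w := by
  obtain ⟨e, he⟩ := hG.isInvertible hu
  apply e.injective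
  have : G u v = G u w := ContinuousLinearMap.ext h
  rwa [← he] at this

lemma mem_nhds (hG : IsMetricOn G U) (hu : u ∈ U) : U ∈ nhds u := hG.isOpen.mem_nhds hu

lemma contDiffAt (hG : IsMetricOn G U) (hu : u ∈ U) : ContDiffAt ℝ ∞ G u :=
  hG.smooth.contDiffAt (hG.mem_nhds hu)

lemma differentiableAt (hG : IsMetricOn G U) (hu : u ∈ U) : DifferentiableAt ℝ G u :=
  (hG.contDiffAt hu).differentiableAt (by simp)

lemma contDiffOn_fderiv_apply (hG : IsMetricOn G U) (v : E) :
    ContDiffOn ℝ ∞ (fun u => fderiv ℝ G u v) U :=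
  (hG.smooth.fderiv_of_isOpen hG.isOpen (m := ∞) (by simp)).clm_apply contDiffOn_const

lemma contDiffOn_inverse (hG : IsMetricOn G U) : ContDiffOn ℝ ∞ (fun u => (G u).inverse) U :=
  fun _ hu => ((hG.isInvertible hu).contDiffAt_map_inverse.comp _
    (hG.contDiffAt hu)).contDiffWithinAt

lemma contDiffOn_christoffel (hG : IsMetricOn G U) (v w : E) :
    ContDiffOn ℝ ∞ (fun u => christoffel G u v w) U := by
  refine hG.contDiffOn_inverse.clm_apply (ContDiffOn.const_smul (1 / 2 : ℝ) ?_)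
  refine (((hG.contDiffOn_fderiv_apply v).clm_apply contDiffOn_const).add
    ((hG.contDiffOn_fderiv_apply w).clm_apply contDiffOn_const)).sub ?_
  rw [contDiffOn_clm_apply]
  intro z
  exact ((hG.contDiffOn_fderiv_apply z).clm_apply contDiffOn_const).clm_apply contDiffOn_const

lemma contDiffOn_chris (hG : IsMetricOn G U) : ContDiffOn ℝ ∞ (chris G) U := by
  rw [contDiffOn_clm_apply]
  intro v
  rw [contDiffOn_clm_apply]
  exact hG.contDiffOn_christoffel v

lemma differentiableAt_chris (hG : IsMetricOn G U) (hu : u ∈ U) :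
    DifferentiableAt ℝ (chris G) u :=
  (hG.contDiffOn_chris.contDiffAt (hG.mem_nhds hu)).differentiableAt (by simp)

lemma fderiv_apply₂ (hG : IsMetricOn G U) (hu : u ∈ U) (a v w : E) :
    fderiv ℝ (fun y => G y v w) u a = fderiv ℝ G u a v w := by
  have h := hG.differentiableAt hu
  rw [fderiv_clm_apply (h.clm_apply (differentiableAt_const v)) (differentiableAt_const w),
    fderiv_clm_apply h (differentiableAt_const v)]
  simp

/-- Symmetry of `G` holds on the open set `U`, hence near `u`, and can be differentiated. -/
lemma fderiv_symm (hG : IsMetricOn G U) (hu : u ∈ U) (a v w : E) :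
    fderiv ℝ G u a v w = fderiv ℝ G u a w v := by
  rw [← hG.fderiv_apply₂ hu, ← hG.fderiv_apply₂ hu]
  congr 1
  apply Filter.EventuallyEq.fderiv_eq
  filter_upwards [hG.mem_nhds hu] with y hy using hG.symm y hy v w

lemma chris_symm (hG : IsMetricOn G U) (hu : u ∈ U) (v w : E) :
    chris G u v w = chris G u w v := by
  simp only [chris_apply, christoffel]
  congr 2
  ext z
  simp [hG.fderiv_symm hu z v w, add_comm]

lemma apply_chris (hG : IsMetricOn G U) (hu : u ∈ U) (v w z : E) :
    G u (chris G u v w) z =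
      1 / 2 * (fderiv ℝ G u v w z + fderiv ℝ G u w v z - fderiv ℝ G u z v w) := by
  simp only [chris_apply, christoffel]
  rw [hG.apply_inverse hu]
  simp

/-- The Levi-Civita connection is metric. -/
lemma fderiv_eq (hG : IsMetricOn G U) (hu : u ∈ U) (a v w : E) :
    fderiv ℝ G u a v w = G u (chris G u a v) w + G u v (chris G u a w) := by
  rw [hG.symm u hu v, hG.apply_chris hu, hG.apply_chris hu, hG.fderiv_symm hu a w v,
    hG.fderiv_symm hu w a v, hG.fderiv_symm hu v a w]
  ring

end IsMetricOn

end Christoffel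

/-! ### Pull-back connection, second fundamental form and Codazzi equation. -/

section Connection

variable [FiniteDimensional ℝ E] [FiniteDimensional ℝ F]
  {G : E → E →L[ℝ] E →L[ℝ] ℝ} {H : F → F →L[ℝ] F →L[ℝ] ℝ} {f : E → F} {U : Set E} {V : Set F}
  {u : E}

/-- `G`, `H` are metrics on `U`, `V` and `f` is a smooth map from `U` to `V`. -/
structure IsMapOn (G : E → E →L[ℝ] E →L[ℝ] ℝ) (H : F → F →L[ℝ] F →L[ℝ] ℝ) (f : E → F)
    (U : Set E) (V : Set F) : Prop where
  source : IsMetricOn G U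
  target : IsMetricOn H V
  smooth : ContDiffOn ℝ ∞ f U
  mapsTo : Set.MapsTo f U V

/-- The derivative of a `CLM`-valued function applied to a fixed vector. -/
lemma fderiv_clm_apply_const {c : E → E →L[ℝ] F} (hc : DifferentiableAt ℝ c u) (a v : E) :
    fderiv ℝ (fun y => c y v) u a = fderiv ℝ c u a v := by
  rw [fderiv_clm_apply hc (differentiableAt_const v)]
  simp

lemma fderiv_clm_apply_apply {c : E → E →L[ℝ] F} {W : E → E} (hc : DifferentiableAt ℝ c u)
    (hW : DifferentiableAt ℝ W u) (a : E) :
    fderiv ℝ (fun y => c y (W y)) u a = fderiv ℝ c u a (W u) + c u (fderiv ℝ W u a) := by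
  rw [fderiv_clm_apply hc hW]
  simp [add_comm]

lemma IsMapOn.contDiffOn_fderiv (hf : IsMapOn G H f U V) : ContDiffOn ℝ ∞ (fderiv ℝ f) U :=
  hf.smooth.fderiv_of_isOpen hf.source.isOpen (by simp)

lemma IsMapOn.differentiableAt (hf : IsMapOn G H f U V) (hu : u ∈ U) : DifferentiableAt ℝ f u :=
  (hf.smooth.contDiffAt (hf.source.mem_nhds hu)).differentiableAt (by simp)

lemma IsMapOn.differentiableAt_fderiv (hf : IsMapOn G H f U V) (hu : u ∈ U) :
    DifferentiableAt ℝ (fderiv ℝ f) u :=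
  (hf.contDiffOn_fderiv.contDiffAt (hf.source.mem_nhds hu)).differentiableAt (by simp)

lemma IsMapOn.fderiv_fderiv_symm (hf : IsMapOn G H f U V) (hu : u ∈ U) (a b : E) :
    fderiv ℝ (fderiv ℝ f) u a b = fderiv ℝ (fderiv ℝ f) u b a :=
  (hf.smooth.contDiffAt (hf.source.mem_nhds hu)).isSymmSndFDerivAt
    (by rw [minSmoothness_of_isRCLikeNormedField]; exact WithTop.coe_le_coe.2 le_top) a b

lemma cov_eq (W : E → E) (a : E) :
    cov G W u a = fderiv ℝ W u a + chris G u a (W u) := rfl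

lemma covAlong_eq (Ψ : E → F) (a : E) :
    covAlong H f Ψ u a = fderiv ℝ Ψ u a + chris H (f u) (fderiv ℝ f u a) (Ψ u) := rfl

lemma covAlong_congr {Ψ Ψ' : E → F} (h : Ψ =ᶠ[nhds u] Ψ') (a : E) :
    covAlong H f Ψ u a = covAlong H f Ψ' u a := by
  rw [covAlong, covAlong, h.fderiv_eq, h.eq_of_nhds]

lemma covAlong_add {Ψ Ψ' : E → F} (h : DifferentiableAt ℝ Ψ u) (h' : DifferentiableAt ℝ Ψ' u)
    (a : E) :
    covAlong H f (fun y => Ψ y + Ψ' y) u a = covAlong H f Ψ u a + covAlong H f Ψ' u a := by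
  simp only [covAlong_eq, fderiv_fun_add h h', map_add, add_apply]
  abel

lemma covAlong_const_smul {Ψ : E → F} (h : DifferentiableAt ℝ Ψ u) (c : ℝ) (a : E) :
    covAlong H f (fun y => c • Ψ y) u a = c • covAlong H f Ψ u a := by
  simp only [covAlong_eq, fderiv_fun_const_smul h, map_smul, smul_apply,
    smul_add]

/-- The second fundamental form as a bilinear map. -/
noncomputable def sff (G : E → E →L[ℝ] E →L[ℝ] ℝ) (H : F → F →L[ℝ] F →L[ℝ] ℝ) (f : E → F) (u : E) :
    E →L[ℝ] E →L[ℝ] F :=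
  mkBilin (fun a b => fderiv ℝ (fderiv ℝ f) u a b + chris H (f u) (fderiv ℝ f u a) (fderiv ℝ f u b)
      - fderiv ℝ f u (chris G u a b))
    (fun _ _ _ => by simp; abel) (fun _ _ _ => by simp [smul_sub]) (fun _ _ _ => by simp; abel)
    (fun _ _ _ => by simp [smul_sub])

lemma sff_apply (a b : E) : sff G H f u a b = fderiv ℝ (fderiv ℝ f) u a b +
    chris H (f u) (fderiv ℝ f u a) (fderiv ℝ f u b) - fderiv ℝ f u (chris G u a b) := rfl

lemma IsMapOn.secondFundForm_eq (hf : IsMapOn G H f U V) (hu : u ∈ U) (a b : E) :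
    secondFundForm G H f u a b = sff G H f u a b := by
  rw [secondFundForm, covAlong_eq, fderiv_clm_apply_const (hf.differentiableAt_fderiv hu)]
  rfl

lemma IsMapOn.sff_symm (hf : IsMapOn G H f U V) (hu : u ∈ U) (a b : E) :
    sff G H f u a b = sff G H f u b a := by
  rw [sff_apply, sff_apply, hf.fderiv_fderiv_symm hu, hf.source.chris_symm hu,
    hf.target.chris_symm (hf.mapsTo hu)]

lemma IsMapOn.contDiffOn_sff (hf : IsMapOn G H f U V) : ContDiffOn ℝ ∞ (sff G H f) U := by
  have hD := hf.contDiffOn_fderiv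
  have hD2 : ContDiffOn ℝ ∞ (fderiv ℝ (fderiv ℝ f)) U :=
    hD.fderiv_of_isOpen hf.source.isOpen (by simp)
  have hΓ : ContDiffOn ℝ ∞ (fun y => chris H (f y)) U :=
    hf.target.contDiffOn_chris.comp hf.smooth hf.mapsTo
  rw [contDiffOn_clm_apply]
  intro a
  rw [contDiffOn_clm_apply]
  intro b
  have ha := hD.clm_apply (contDiffOn_const (c := a))
  have hb := hD.clm_apply (contDiffOn_const (c := b))
  exact (((hD2.clm_apply contDiffOn_const).clm_apply contDiffOn_const).add
    ((hΓ.clm_apply ha).clm_apply hb)).sub (hD.clm_apply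
      ((hf.source.contDiffOn_chris.clm_apply contDiffOn_const).clm_apply contDiffOn_const))

lemma IsMapOn.differentiableAt_sff (hf : IsMapOn G H f U V) (hu : u ∈ U) :
    DifferentiableAt ℝ (sff G H f) u :=
  (hf.contDiffOn_sff.contDiffAt (hf.source.mem_nhds hu)).differentiableAt (by simp)

/-- `∇_a (df W) = ∇df(a, W) + df(∇_a W)`. -/
lemma IsMapOn.covAlong_fderiv (hf : IsMapOn G H f U V) (hu : u ∈ U) {W : E → E}
    (hW : DifferentiableAt ℝ W u) (a : E) :
    covAlong H f (fun y => fderiv ℝ f y (W y)) u a =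
      sff G H f u a (W u) + fderiv ℝ f u (cov G W u a) := by
  rw [covAlong_eq, fderiv_clm_apply_apply (hf.differentiableAt_fderiv hu) hW, cov_eq, sff_apply,
    map_add]
  abel

/-- The curvature of the pull-back connection. -/
lemma IsMapOn.covAlong_comm (hf : IsMapOn G H f U V) (hu : u ∈ U) {Ψ : E → F}
    (hΨ : ContDiffAt ℝ ∞ Ψ u) (a b : E) :
    covAlong H f (fun y => covAlong H f Ψ y b) u a - covAlong H f (fun y => covAlong H f Ψ y a) u b
      = curv H (f u) (fderiv ℝ f u a) (fderiv ℝ f u b) (Ψ u) := by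
  have hΨ1 : DifferentiableAt ℝ Ψ u := hΨ.differentiableAt (by simp)
  have hΨ2 : DifferentiableAt ℝ (fderiv ℝ Ψ) u :=
    (hΨ.fderiv_right (m := ∞) (by simp)).differentiableAt (by simp)
  have hsymm : fderiv ℝ (fderiv ℝ Ψ) u a b = fderiv ℝ (fderiv ℝ Ψ) u b a :=
    hΨ.isSymmSndFDerivAt
      (by rw [minSmoothness_of_isRCLikeNormedField]; exact WithTop.coe_le_coe.2 le_top) a b
  have hf1 := hf.differentiableAt hu
  have hf2 := hf.differentiableAt_fderiv hu
  have hΓ := hf.target.differentiableAt_chris (hf.mapsTo hu)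
  -- Once expanded, the second derivatives of `Ψ` and of `f` are symmetric in `a`, `b`. The terms
  -- with one derivative of `Ψ` cancel against those of the outer covariant derivative, so only the
  -- curvature survives.
  have key : ∀ a b, fderiv ℝ (fun y => covAlong H f Ψ y b) u a =
      fderiv ℝ (fderiv ℝ Ψ) u a b +
        (fderiv ℝ (chris H) (f u) (fderiv ℝ f u a) (fderiv ℝ f u b) (Ψ u) +
          chris H (f u) (fderiv ℝ (fderiv ℝ f) u a b) (Ψ u) +
          chris H (f u) (fderiv ℝ f u b) (fderiv ℝ Ψ u a)) := by
    intro a b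
    have hfb : DifferentiableAt ℝ (fun y => fderiv ℝ f y b) u :=
      hf2.clm_apply (differentiableAt_const b)
    have h1 : HasFDerivAt (fun y => chris H (f y)) ((fderiv ℝ (chris H) (f u)).comp (fderiv ℝ f u))
      u := hΓ.hasFDerivAt.comp u hf1.hasFDerivAt
    have h2 : HasFDerivAt (fun y => fderiv ℝ f y b) ((fderiv ℝ (fderiv ℝ f) u).flip b) u := by
      simpa using hf2.hasFDerivAt.clm_apply (hasFDerivAt_const b u)
    have h3 : HasFDerivAt (fun y => fderiv ℝ Ψ y b) ((fderiv ℝ (fderiv ℝ Ψ) u).flip b) u := by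
      simpa using hΨ2.hasFDerivAt.clm_apply (hasFDerivAt_const b u)
    have h4 := h3.add ((h1.clm_apply h2).clm_apply hΨ1.hasFDerivAt)
    have h5 := h4.fderiv
    have h6 : (fun y => covAlong H f Ψ y b) =
      ((fun y => fderiv ℝ Ψ y b) + fun y => chris H (f y) (fderiv ℝ f y b) (Ψ y)) := rfl
    rw [h6, h5]
    simp
    abel
  have hcurv : ∀ v a' b' : F, v ∈ V → fderiv ℝ (fun y => christoffel H y b' (Ψ u)) v a' =
      fderiv ℝ (chris H) v a' b' (Ψ u) := by
    intro v a' b' hv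
    have hd := hf.target.differentiableAt_chris hv
    have h1 : HasFDerivAt (fun y => chris H y b' (Ψ u)) _ v :=
      (hd.hasFDerivAt.clm_apply (hasFDerivAt_const b' v)).clm_apply (hasFDerivAt_const (Ψ u) v)
    have h2 : (fun y => christoffel H y b' (Ψ u)) = fun y => chris H y b' (Ψ u) := rfl
    rw [h2, h1.fderiv]
    simp
  rw [covAlong_eq (fun y => covAlong H f Ψ y b) a, covAlong_eq (fun y => covAlong H f Ψ y a) b,
    key, key, hsymm, hf.fderiv_fderiv_symm hu a b, curv, cov, cov,
    hcurv _ _ _ (hf.mapsTo hu), hcurv _ _ _ (hf.mapsTo hu)]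
  simp only [← chris_apply, covAlong_eq, map_add]
  abel

lemma IsMapOn.differentiableAt_sff_apply (hf : IsMapOn G H f U V) (hu : u ∈ U) (a b : E) :
    DifferentiableAt ℝ (fun y => sff G H f y a b) u :=
  ((hf.differentiableAt_sff hu).clm_apply (differentiableAt_const a)).clm_apply
    (differentiableAt_const b)

/-- The Codazzi equation for `∇df`. -/
lemma IsMapOn.codazzi (hf : IsMapOn G H f U V) (hu : u ∈ U) (a b c : E) :
    covAlong H f (fun y => sff G H f y b c) u a - covAlong H f (fun y => sff G H f y a c) u b =
      curv H (f u) (fderiv ℝ f u a) (fderiv ℝ f u b) (fderiv ℝ f u c)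
        - fderiv ℝ f u (curv G u a b c)
        - sff G H f u a (chris G u b c) + sff G H f u b (chris G u a c) := by
  have hΓ : ∀ b, DifferentiableAt ℝ (fun y => chris G y b c) u := fun b =>
    ((hf.source.differentiableAt_chris hu).clm_apply (differentiableAt_const b)).clm_apply
      (differentiableAt_const c)
  -- Near `u`, `∇df(b, c) = ∇_b(df c) - df(∇_b c)`. Antisymmetrised in `a`, `b`, the first term
  -- gives the target curvature and the second the source curvature.
  have key : ∀ a b, covAlong H f (fun y => sff G H f y b c) u a =
      covAlong H f (fun y => covAlong H f (fun z => fderiv ℝ f z c) y b) u a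
        - (sff G H f u a (chris G u b c) + fderiv ℝ f u (cov G (fun y => chris G y b c) u a)) := by
    intro a b
    have h1 : (fun y => covAlong H f (fun z => fderiv ℝ f z c) y b) =ᶠ[nhds u]
        fun y => sff G H f y b c + fderiv ℝ f y (chris G y b c) := by
      filter_upwards [hf.source.mem_nhds hu] with y hy
      rw [hf.covAlong_fderiv hy (differentiableAt_const c), cov_eq]
      simp
    rw [covAlong_congr h1, covAlong_add (hf.differentiableAt_sff_apply hu b c)
      ((hf.differentiableAt_fderiv hu).clm_apply (hΓ b)), hf.covAlong_fderiv hu (hΓ b)]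
    abel
  have hc := hf.covAlong_comm hu (Ψ := fun z => fderiv ℝ f z c)
    ((hf.contDiffOn_fderiv.clm_apply contDiffOn_const).contDiffAt (hf.source.mem_nhds hu)) a b
  rw [key, key, ← hc, curv, map_sub]
  simp only [← chris_apply]
  abel

/-- The covariant derivative `(∇_c ∇df)(a, b)`. -/
noncomputable def covSff (G : E → E →L[ℝ] E →L[ℝ] ℝ) (H : F → F →L[ℝ] F →L[ℝ] ℝ) (f : E → F)
    (u c a b : E) : F :=
  covAlong H f (fun y => sff G H f y a b) u c - sff G H f u (chris G u c a) b
    - sff G H f u a (chris G u c b)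

/-- The second covariant derivative of `df W`, before taking the trace. -/
lemma IsMapOn.hessian_fderiv (hf : IsMapOn G H f U V) (hu : u ∈ U) {W : E → E}
    (hW : ContDiffOn ℝ ∞ W U) (a b : E) :
    covAlong H f (fun y => covAlong H f (fun z => fderiv ℝ f z (W z)) y b) u a
        - covAlong H f (fun z => fderiv ℝ f z (W z)) u (chris G u a b)
        + curv H (f u) (fderiv ℝ f u (W u)) (fderiv ℝ f u a) (fderiv ℝ f u b) =
      covSff G H f u (W u) a b + fderiv ℝ f u (curv G u (W u) a b)
        + sff G H f u b (cov G W u a) + sff G H f u a (cov G W u b)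
        + fderiv ℝ f u (cov G (fun y => cov G W y b) u a - cov G W u (chris G u a b)) := by
  have hWd : ∀ y ∈ U, DifferentiableAt ℝ W y := fun y hy =>
    (hW.contDiffAt (hf.source.mem_nhds hy)).differentiableAt (by simp)
  have hcW : DifferentiableAt ℝ (fun y => cov G W y b) u := by
    have : ContDiffOn ℝ ∞ (fun y => cov G W y b) U :=
      ((hW.fderiv_of_isOpen hf.source.isOpen (by simp)).clm_apply contDiffOn_const).add
        ((hf.source.contDiffOn_chris.clm_apply contDiffOn_const).clm_apply hW)
    exact (this.contDiffAt (hf.source.mem_nhds hu)).differentiableAt (by simp)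
  have hSb : DifferentiableAt ℝ (fun y => sff G H f y b) u :=
    (hf.differentiableAt_sff hu).clm_apply (differentiableAt_const b)
  have h1 : (fun y => covAlong H f (fun z => fderiv ℝ f z (W z)) y b) =ᶠ[nhds u]
      fun y => sff G H f y b (W y) + fderiv ℝ f y (cov G W y b) := by
    filter_upwards [hf.source.mem_nhds hu] with y hy
    exact hf.covAlong_fderiv hy (hWd y hy) b
  -- The value of `W` is frozen at `u`, so that the Codazzi equation, stated for constant coordinate
  -- fields, applies with `W u` as an entry.
  have h2 : covAlong H f (fun y => sff G H f y b (W y)) u a =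
      covAlong H f (fun y => sff G H f y b (W u)) u a + sff G H f u b (fderiv ℝ W u a) := by
    rw [covAlong_eq, covAlong_eq, fderiv_clm_apply_apply hSb (hWd u hu),
      fderiv_clm_apply_const hSb]
    abel
  -- Symmetry brings `W u` into the slot that Codazzi exchanges with `a`. The target curvature so
  -- produced is opposite to the one in the Jacobi operator.
  have h3 : covAlong H f (fun y => sff G H f y b (W u)) u a =
      covAlong H f (fun y => sff G H f y (W u) b) u a := by
    apply covAlong_congr
    filter_upwards [hf.source.mem_nhds hu] with y hy using hf.sff_symm hy _ _
  have h4 := hf.codazzi hu a (W u) b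
  have h5 : ∀ G' : F → F →L[ℝ] F →L[ℝ] ℝ, ∀ v a b c, curv G' v a b c = - curv G' v b a c :=
    fun G' v a b c => by simp [curv]
  have h6 : ∀ v a b c, curv G v a b c = - curv G v b a c :=
    fun v a b c => by simp [curv]
  rw [covAlong_congr h1, covAlong_add (hSb.clm_apply (hWd u hu))
    ((hf.differentiableAt_fderiv hu).clm_apply hcW), hf.covAlong_fderiv hu hcW, h2, h3,
    hf.covAlong_fderiv hu (hWd u hu), sub_eq_iff_eq_add.1 h4, covSff, h5 H _ (fderiv ℝ f u a),
    h6 _ a, hf.source.chris_symm hu (W u) a]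
  simp only [cov_eq W, map_sub, map_add, map_neg]
  rw [hf.sff_symm hu (chris G u a (W u)) b, hf.sff_symm hu (chris G u a b)]
  abel

end Connection

end Coord

namespace Coord

variable {E : Type*} [NormedAddCommGroup E] [NormedSpace ℝ E] [FiniteDimensional ℝ E]
  {F : Type*} [NormedAddCommGroup F] [NormedSpace ℝ F]

/-! ### Metric traces in an arbitrary basis, and the Jacobi operator on `df W`. -/

section Trace

lemma metricTrace_add (g : E →L[ℝ] E →L[ℝ] ℝ) (S T : E → E → F) :
    metricTrace g (fun a b => S a b + T a b) = metricTrace g S + metricTrace g T :=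
  Finset.sum_add_distrib

lemma metricTrace_sub (g : E →L[ℝ] E →L[ℝ] ℝ) (S T : E → E → F) :
    metricTrace g (fun a b => S a b - T a b) = metricTrace g S - metricTrace g T :=
  Finset.sum_sub_distrib _ _

lemma metricTrace_smul (g : E →L[ℝ] E →L[ℝ] ℝ) (c : ℝ) (T : E → E → F) :
    metricTrace g (fun a b => c • T a b) = c • metricTrace g T :=
  Finset.smul_sum.symm

lemma metricTrace_map {F' : Type*} [NormedAddCommGroup F'] [NormedSpace ℝ F']
    (g : E →L[ℝ] E →L[ℝ] ℝ) (T : E → E → F) (L : F →L[ℝ] F') :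
    metricTrace g (fun a b => L (T a b)) = L (metricTrace g T) := by
  simp [metricTrace]

/-- The coordinate form of the basis used in `metricTrace`. -/
noncomputable def coform (i : Fin (Module.finrank ℝ E)) : E →L[ℝ] ℝ :=
  LinearMap.toContinuousLinearMap ((Module.finBasis ℝ E).coord i)

lemma coform_apply (i : Fin (Module.finrank ℝ E)) (v : E) :
    coform i v = (Module.finBasis ℝ E).repr v i := rfl

lemma sum_coform_smul (v : E) : ∑ i, coform i v • Module.finBasis ℝ E i = v :=
  (Module.finBasis ℝ E).sum_repr v

variable {G : E → E →L[ℝ] E →L[ℝ] ℝ} {U : Set E} {u : E}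

/-- The metric dual of a coordinate form. -/
noncomputable def dualVec (g : E →L[ℝ] E →L[ℝ] ℝ) (i : Fin (Module.finrank ℝ E)) : E :=
  g.inverse (coform i)

lemma metricTrace_eq (g : E →L[ℝ] E →L[ℝ] ℝ) (T : E → E → F) :
    metricTrace g T = ∑ i, T (Module.finBasis ℝ E i) (dualVec g i) := rfl

lemma IsMetricOn.dualVec_left (hG : IsMetricOn G U) (hu : u ∈ U)
    (i : Fin (Module.finrank ℝ E)) (w : E) : G u (dualVec (G u) i) w = coform i w := by
  rw [dualVec, hG.apply_inverse hu]

lemma IsMetricOn.dualVec_right (hG : IsMetricOn G U) (hu : u ∈ U)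
    (i : Fin (Module.finrank ℝ E)) (w : E) : G u w (dualVec (G u) i) = coform i w := by
  rw [hG.symm u hu, hG.dualVec_left hu]

/-- `∑ e^i(v) g^i`-expansion of the linear map adjoint to `L`. -/
lemma IsMetricOn.sum_coform_apply_smul_dualVec (hG : IsMetricOn G U) (hu : u ∈ U)
    {L L' : E →L[ℝ] E} (h : ∀ v w, G u (L v) w = G u v (L' w))
    (j : Fin (Module.finrank ℝ E)) :
    ∑ i, coform j (L (Module.finBasis ℝ E i)) • dualVec (G u) i = L' (dualVec (G u) j) := by
  refine hG.ext_inner hu fun z => ?_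
  have h1 : G u (L' (dualVec (G u) j)) z = coform j (L z) := by
    rw [hG.symm u hu, ← h, hG.dualVec_right hu]
  rw [h1]
  conv_rhs => rw [← sum_coform_smul z]
  simp [hG.dualVec_left hu, mul_comm]

/-- Both sides expand through the matrix of `L`; its transpose acts on the dual vectors as the
adjoint `L'`. -/
lemma IsMetricOn.metricTrace_adjoint (hG : IsMetricOn G U) (hu : u ∈ U) {L L' : E →L[ℝ] E}
    (h : ∀ v w, G u (L v) w = G u v (L' w)) (T : E →L[ℝ] E →L[ℝ] F) :
    metricTrace (G u) (fun a b => T (L a) b) = metricTrace (G u) (fun a b => T a (L' b)) := by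
  simp only [metricTrace_eq, ← hG.sum_coform_apply_smul_dualVec hu h]
  simp only [map_sum, map_smul]
  rw [Finset.sum_comm]
  refine Finset.sum_congr rfl fun i _ => ?_
  conv_lhs => rw [← sum_coform_smul (L (Module.finBasis ℝ E i))]
  simp

/-- The trace is a contraction with the matrix `g^{ij}`, the Gram matrix of the dual vectors, which
is symmetric. `T` itself need not be. -/
lemma IsMetricOn.metricTrace_flip (hG : IsMetricOn G U) (hu : u ∈ U) (T : E →L[ℝ] E →L[ℝ] F) :
    metricTrace (G u) (fun a b => T b a) = metricTrace (G u) (fun a b => T a b) := by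
  have h : ∀ i, dualVec (G u) i = ∑ j, G u (dualVec (G u) i) (dualVec (G u) j) •
      Module.finBasis ℝ E j := by
    intro i
    conv_lhs => rw [← sum_coform_smul (dualVec (G u) i)]
    simp only [hG.dualVec_right hu]
  simp only [metricTrace_eq]
  calc _ = ∑ i, ∑ j, G u (dualVec (G u) i) (dualVec (G u) j) •
          T (Module.finBasis ℝ E j) (Module.finBasis ℝ E i) := by
        refine Finset.sum_congr rfl fun i _ => ?_
        conv_lhs => rw [h i]
        simp
    _ = _ := by
        rw [Finset.sum_comm]
        refine Finset.sum_congr rfl fun i _ => ?_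
        conv_rhs => rw [h i]
        simp [hG.symm u hu (dualVec (G u) i)]

/-- Contracting the form `α` with the metric raises its index: `∑ α(b_i) g^i = v`. -/
lemma IsMetricOn.metricTrace_smul_right (hG : IsMetricOn G U) (hu : u ∈ U) {α : E → ℝ} {v : E}
    (h : ∀ w, G u v w = α w) (M : E →L[ℝ] F) :
    metricTrace (G u) (fun a b => α a • M b) = M v := by
  have : ∑ i, α (Module.finBasis ℝ E i) • dualVec (G u) i = v := by
    refine hG.ext_inner hu fun z => ?_
    conv_rhs => rw [← sum_coform_smul z]
    simp [hG.dualVec_left hu, ← h, mul_comm]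
  rw [metricTrace_eq, ← this]
  simp

lemma IsMetricOn.metricTrace_smul_left (hG : IsMetricOn G U) (hu : u ∈ U) {α : E → ℝ} {v : E}
    (h : ∀ w, G u v w = α w) (M : E →L[ℝ] F) :
    metricTrace (G u) (fun a b => α b • M a) = M v := by
  rw [metricTrace_eq]
  simp only [← h, hG.dualVec_right hu]
  conv_rhs => rw [← sum_coform_smul v]
  simp

lemma IsMetricOn.metricTrace_self (hG : IsMetricOn G U) (hu : u ∈ U) :
    metricTrace (G u) (fun a b => G u a b) = (Module.finrank ℝ E : ℝ) := by
  rw [metricTrace_eq]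
  simp [hG.dualVec_right hu, coform_apply]

lemma IsMetricOn.contDiffOn_dualVec (hG : IsMetricOn G U) (i : Fin (Module.finrank ℝ E)) :
    ContDiffOn ℝ ∞ (fun y => dualVec (G y) i) U :=
  hG.contDiffOn_inverse.clm_apply contDiffOn_const

/-- Differentiate `G(g^i, w) = e^i(w)`, whose right side is constant, and use that the connection is
metric. -/
lemma IsMetricOn.fderiv_dualVec (hG : IsMetricOn G U) (hu : u ∈ U)
    (i : Fin (Module.finrank ℝ E)) (c w : E) :
    G u (fderiv ℝ (fun y => dualVec (G y) i) u c) w =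
      - G u (chris G u c (dualVec (G u) i)) w - coform i (chris G u c w) := by
  have hd : DifferentiableAt ℝ (fun y => dualVec (G y) i) u :=
    ((hG.contDiffOn_dualVec i).contDiffAt (hG.mem_nhds hu)).differentiableAt (by simp)
  have h1 : (fun y => G y (dualVec (G y) i) w) =ᶠ[nhds u] fun _ => coform i w := by
    filter_upwards [hG.mem_nhds hu] with y hy using hG.dualVec_left hy i w
  have h2 : HasFDerivAt (fun y => G y (dualVec (G y) i) w) _ u :=
    ((hG.differentiableAt hu).hasFDerivAt.clm_apply hd.hasFDerivAt).clm_apply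
      (hasFDerivAt_const w u)
  have h3 := congrArg (fun L : E →L[ℝ] ℝ => L c) (h2.fderiv.symm.trans h1.fderiv_eq)
  simp only [fderiv_fun_const] at h3
  simp [hG.fderiv_eq hu, hG.dualVec_left hu] at h3
  linarith

variable [FiniteDimensional ℝ F] {H : F → F →L[ℝ] F →L[ℝ] ℝ} {f : E → F} {V : Set F}

lemma covAlong_sum {ι : Type*} (s : Finset ι) {Ψ : ι → E → F}
    (h : ∀ i ∈ s, DifferentiableAt ℝ (Ψ i) u) (a : E) :
    covAlong H f (fun y => ∑ i ∈ s, Ψ i y) u a = ∑ i ∈ s, covAlong H f (Ψ i) u a := by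
  simp only [covAlong_eq, fderiv_fun_sum h, map_sum, sum_apply, Finset.sum_add_distrib]

lemma IsMapOn.tension_eq (hf : IsMapOn G H f U V) (hu : u ∈ U) :
    tension G H f u = metricTrace (G u) (fun a b => sff G H f u a b) := by
  simp only [tension, metricTrace, hf.secondFundForm_eq hu]

/-- The trace commutes with covariant differentiation. -/
lemma IsMapOn.metricTrace_covSff (hf : IsMapOn G H f U V) (hu : u ∈ U) (c : E) :
    metricTrace (G u) (covSff G H f u c) = covAlong H f (tension G H f) u c := by
  have hG := hf.source
  have hd : ∀ i, DifferentiableAt ℝ (fun y => dualVec (G y) i) u := fun i =>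
    ((hG.contDiffOn_dualVec i).contDiffAt (hG.mem_nhds hu)).differentiableAt (by simp)
  have hS : ∀ a, DifferentiableAt ℝ (fun y => sff G H f y a) u := fun a =>
    (hf.differentiableAt_sff hu).clm_apply (differentiableAt_const a)
  have h1 : tension G H f =ᶠ[nhds u]
      fun y => ∑ i, sff G H f y (Module.finBasis ℝ E i) (dualVec (G y) i) := by
    filter_upwards [hG.mem_nhds hu] with y hy
    rw [hf.tension_eq hy, metricTrace_eq]
  have h2 : ∀ i, covAlong H f (fun y => sff G H f y (Module.finBasis ℝ E i) (dualVec (G y) i)) u c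
      = covAlong H f (fun y => sff G H f y (Module.finBasis ℝ E i) (dualVec (G u) i)) u c
        + sff G H f u (Module.finBasis ℝ E i) (fderiv ℝ (fun y => dualVec (G y) i) u c) := by
    intro i
    rw [covAlong_eq, covAlong_eq, fderiv_clm_apply_apply (hS _) (hd i),
      fderiv_clm_apply_const (hS _)]
    abel
  -- The two terms supply the two Christoffel corrections in `covSff`: the first acts on the second
  -- slot at once, and the transposed one moves to the first slot after summation (`h4`).
  have h3 : ∀ i, fderiv ℝ (fun y => dualVec (G y) i) u c =
      - chris G u c (dualVec (G u) i) -
        (G u).inverse ((coform i).comp (chris G u c)) := by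
    intro i
    refine hG.ext_inner hu fun z => ?_
    rw [hG.fderiv_dualVec hu]
    simp [hG.apply_inverse hu]
  have h4 : ∑ i, sff G H f u (Module.finBasis ℝ E i)
      ((G u).inverse ((coform i).comp (chris G u c))) =
      ∑ i, sff G H f u (chris G u c (Module.finBasis ℝ E i)) (dualVec (G u) i) := by
    have h5 : ∀ i, (G u).inverse ((coform i).comp (chris G u c)) =
        ∑ j, coform i (chris G u c (Module.finBasis ℝ E j)) • dualVec (G u) j := by
      intro i
      refine hG.ext_inner hu fun z => ?_
      rw [hG.apply_inverse hu]
      conv_lhs => rw [← sum_coform_smul z]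
      simp [hG.dualVec_left hu, mul_comm]
    simp only [h5, map_sum, map_smul]
    rw [Finset.sum_comm]
    refine Finset.sum_congr rfl fun i _ => ?_
    conv_rhs => rw [← sum_coform_smul (chris G u c (Module.finBasis ℝ E i))]
    simp
  rw [covAlong_congr h1, covAlong_sum _ (fun i _ => (hS _).clm_apply (hd i))]
  simp only [h2, h3, map_sub, map_neg, Finset.sum_add_distrib, Finset.sum_sub_distrib,
    Finset.sum_neg_distrib, h4, metricTrace_eq, covSff]
  abel

/-- The Jacobi operator of `f` applied to `df W`. -/
lemma IsMapOn.jacobi_fderiv (hf : IsMapOn G H f U V) (hu : u ∈ U) {W : E → E}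
    (hW : ContDiffOn ℝ ∞ W U) (P : E →L[ℝ] E) (hP : ∀ a, cov G W u a = P a) :
    roughLaplacianAlong G H f (fun y => fderiv ℝ f y (W y)) u
        + ricciAlong G H f u (fderiv ℝ f u (W u)) =
      covAlong H f (tension G H f) u (W u)
        + (2 : ℝ) • metricTrace (G u) (fun a b => sff G H f u a (P b))
        + fderiv ℝ f u (roughLaplacian G W u + ricci G u (W u)) := by
  have hflip : metricTrace (G u) (fun a b => sff G H f u b (P a)) =
      metricTrace (G u) (fun a b => sff G H f u a (P b)) := by
    simpa using hf.source.metricTrace_flip hu ((sff G H f u).flip.comp P).flip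
  have hR := metricTrace_map (G u) (fun a b => curv G u (W u) a b) (fderiv ℝ f u)
  have hL := metricTrace_map (G u)
    (fun a b => cov G (fun y => cov G W y b) u a - cov G W u (chris G u a b)) (fderiv ℝ f u)
  have hC : metricTrace (G u) (fun a b => covSff G H f u (W u) a b) =
      covAlong H f (tension G H f) u (W u) := hf.metricTrace_covSff hu (W u)
  have key : (fun a b => covAlong H f (fun y => covAlong H f (fun z => fderiv ℝ f z (W z)) y b) u a
        - covAlong H f (fun z => fderiv ℝ f z (W z)) u (christoffel G u a b)
        + curv H (f u) (fderiv ℝ f u (W u)) (fderiv ℝ f u a) (fderiv ℝ f u b)) =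
      fun a b => covSff G H f u (W u) a b + fderiv ℝ f u (curv G u (W u) a b)
        + sff G H f u b (P a) + sff G H f u a (P b)
        + fderiv ℝ f u (cov G (fun y => cov G W y b) u a - cov G W u (chris G u a b)) := by
    funext a b
    rw [← hP, ← hP]
    exact hf.hessian_fderiv hu hW a b
  rw [roughLaplacianAlong, ricciAlong, ← metricTrace_add, key, metricTrace_add, metricTrace_add,
    metricTrace_add, metricTrace_add, hR, hL, hC, hflip, map_add, two_smul]
  simp only [roughLaplacian, ricci, chris_apply]
  abel

end Trace

end Coord

/-! ### Almost Hermitian structures: `∇J` and the Lee form. -/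

namespace Coord

variable {E : Type*} [NormedAddCommGroup E] [NormedSpace ℝ E] [FiniteDimensional ℝ E]
  {F : Type*} [NormedAddCommGroup F] [NormedSpace ℝ F] [FiniteDimensional ℝ F]

/-- `J` is a smooth almost complex structure on `U`, where `G` is a metric. -/
structure IsAlmostComplexOn (G : E → E →L[ℝ] E →L[ℝ] ℝ) (J : E → E →L[ℝ] E) (U : Set E) : Prop
    where
  metric : IsMetricOn G U
  smooth : ContDiffOn ℝ ∞ J U
  sq : ∀ u ∈ U, ∀ v : E, J u (J u v) = -v

variable {G : E → E →L[ℝ] E →L[ℝ] ℝ} {J : E → E →L[ℝ] E} {U : Set E} {u : E}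

namespace IsAlmostComplexOn

lemma differentiableAt (hJ : IsAlmostComplexOn G J U) (hu : u ∈ U) : DifferentiableAt ℝ J u :=
  (hJ.smooth.contDiffAt (hJ.metric.mem_nhds hu)).differentiableAt (by simp)

lemma nablaJ_eq (hJ : IsAlmostComplexOn G J U) (hu : u ∈ U) (a b : E) :
    nablaJ G J u a b = fderiv ℝ J u a b + chris G u a (J u b) - J u (chris G u a b) := by
  rw [nablaJ, cov_eq, fderiv_clm_apply_const (hJ.differentiableAt hu)]
  rfl

/-- `(∇_a J) J = - J (∇_a J)`. -/
lemma nablaJ_apply_J (hJ : IsAlmostComplexOn G J U) (hu : u ∈ U) (a b : E) :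
    nablaJ G J u a (J u b) = - J u (nablaJ G J u a b) := by
  have hd := hJ.differentiableAt hu
  have h1 : (fun y => J y (J y b)) =ᶠ[nhds u] fun _ => -b := by
    filter_upwards [hJ.metric.mem_nhds hu] with y hy using hJ.sq y hy b
  have h2 : fderiv ℝ (fun y => J y (J y b)) u a = 0 := by
    rw [h1.fderiv_eq, fderiv_fun_const]
    rfl
  rw [fderiv_clm_apply_apply hd (hd.clm_apply (differentiableAt_const b)),
    fderiv_clm_apply_const hd] at h2
  rw [hJ.nablaJ_eq hu, hJ.nablaJ_eq hu, hJ.sq u hu, map_sub, map_add, hJ.sq u hu, map_neg,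
    eq_neg_of_add_eq_zero_left h2]
  abel

/-- On a quasi-Kähler manifold, `(∇_{Jv} J) v + J (∇_v J) v = 0`. -/
lemma nablaJ_diag (hJ : IsAlmostComplexOn G J U) (hu : u ∈ U)
    (h : ∀ a b, nablaJ G J u a b + nablaJ G J u (J u a) (J u b) = 0) (v : E) :
    nablaJ G J u (J u v) v + J u (nablaJ G J u v v) = 0 := by
  have h1 := h v v
  rw [hJ.nablaJ_apply_J hu] at h1
  have h2 : nablaJ G J u v v = J u (nablaJ G J u (J u v) v) := by
    rwa [← sub_eq_add_neg, sub_eq_zero] at h1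
  rw [h2, hJ.sq u hu]
  abel

end IsAlmostComplexOn

/-- `(G, J)` is an almost Hermitian structure on `U`, the one-form `θ` is closed with
`dΩ = θ ∧ Ω` for the fundamental form `Ω`, and `B` is the vector field dual to `θ`. -/
structure IsLeeOn (G : E → E →L[ℝ] E →L[ℝ] ℝ) (J : E → E →L[ℝ] E)
    (Ω : E → E →L[ℝ] E →L[ℝ] ℝ) (θ : E → E →L[ℝ] ℝ) (B : E → E) (U : Set E) : Prop
    extends IsAlmostComplexOn G J U where
  isometry : ∀ u ∈ U, ∀ v w : E, G u (J u v) (J u w) = G u v w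
  smooth_form : ContDiffOn ℝ ∞ θ U
  closed : ∀ u ∈ U, ∀ a b : E, dOne θ u a b = 0
  form_eq : ∀ u ∈ U, ∀ a b : E, Ω u a b = G u a (J u b)
  smooth_Ω : ContDiffOn ℝ ∞ Ω U
  dOmega : ∀ u ∈ U, ∀ a b c : E, dTwo Ω u a b c = wedgeOneTwo (θ u) (Ω u) a b c
  dual : ∀ u ∈ U, ∀ v : E, G u (B u) v = θ u v

variable {Ω : E → E →L[ℝ] E →L[ℝ] ℝ} {θ : E → E →L[ℝ] ℝ} {B : E → E}

namespace IsLeeOn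

lemma mono (h : IsLeeOn G J Ω θ B U) {W : Set E} (hW : IsOpen W) (hWU : W ⊆ U) :
    IsLeeOn G J Ω θ B W where
  metric := ⟨hW, h.metric.smooth.mono hWU, fun u hu => h.metric.symm u (hWU hu),
    fun u hu => h.metric.pos u (hWU hu)⟩
  smooth := h.smooth.mono hWU
  sq u hu := h.sq u (hWU hu)
  isometry u hu := h.isometry u (hWU hu)
  smooth_form := h.smooth_form.mono hWU
  closed u hu := h.closed u (hWU hu)
  form_eq u hu := h.form_eq u (hWU hu)
  smooth_Ω := h.smooth_Ω.mono hWU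
  dOmega u hu := h.dOmega u (hWU hu)
  dual u hu := h.dual u (hWU hu)

lemma adjoint_J (h : IsLeeOn G J Ω θ B U) (hu : u ∈ U) (v w : E) :
    G u v (J u w) = - G u (J u v) w := by
  rw [← h.isometry u hu v, h.sq u hu, map_neg]

lemma smooth_dual (h : IsLeeOn G J Ω θ B U) : ContDiffOn ℝ ∞ B U := by
  refine (h.metric.contDiffOn_inverse.clm_apply h.smooth_form).congr fun y hy => ?_
  rw [eq_comm, (h.metric.isInvertible hy).inverse_apply_eq]
  ext v
  exact (h.dual y hy v).symm

lemma differentiableAt_dual (h : IsLeeOn G J Ω θ B U) (hu : u ∈ U) : DifferentiableAt ℝ B u :=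
  (h.smooth_dual.contDiffAt (h.metric.mem_nhds hu)).differentiableAt (by simp)

/-- Leibniz rule for `G(b, Jc)` with a metric connection. The Christoffel terms are kept because
they cancel only in the alternating sum `dΩ`, by torsion-freeness. -/
lemma fderiv_Ω (h : IsLeeOn G J Ω θ B U) (hu : u ∈ U) (a b c : E) :
    fderiv ℝ Ω u a b c = G u b (nablaJ G J u a c) + G u (chris G u a b) (J u c)
      + G u b (J u (chris G u a c)) := by
  have hG := h.metric
  have hΩ : DifferentiableAt ℝ Ω u :=
    (h.smooth_Ω.contDiffAt (hG.mem_nhds hu)).differentiableAt (by simp)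
  have hGb : DifferentiableAt ℝ (fun y => G y b) u :=
    (hG.differentiableAt hu).clm_apply (differentiableAt_const b)
  have hJ := h.differentiableAt hu
  have hΩb : DifferentiableAt ℝ (fun y => Ω y b) u := hΩ.clm_apply (differentiableAt_const b)
  have h1 : fderiv ℝ Ω u a b c = fderiv ℝ (fun y => G y b (J y c)) u a := by
    rw [← fderiv_clm_apply_const hΩ, ← fderiv_clm_apply_const hΩb]
    congr 1
    apply Filter.EventuallyEq.fderiv_eq
    filter_upwards [hG.mem_nhds hu] with y hy using h.form_eq y hy b c
  rw [h1, fderiv_clm_apply_apply hGb (hJ.clm_apply (differentiableAt_const c)),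
    fderiv_clm_apply_const (hG.differentiableAt hu), fderiv_clm_apply_const hJ,
    hG.fderiv_eq hu, h.nablaJ_eq hu]
  simp only [map_add, map_sub]
  ring

/-- The derivative of `Ω(b, c) = -Ω(c, b)`, which expresses that `J` is skew for `G`. -/
lemma nablaJ_skew (h : IsLeeOn G J Ω θ B U) (hu : u ∈ U) (a b c : E) :
    G u b (nablaJ G J u a c) = - G u c (nablaJ G J u a b) := by
  have hG := h.metric
  have hΩ : DifferentiableAt ℝ Ω u :=
    (h.smooth_Ω.contDiffAt (hG.mem_nhds hu)).differentiableAt (by simp)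
  have hΩb : ∀ b, DifferentiableAt ℝ (fun y => Ω y b) u :=
    fun b => hΩ.clm_apply (differentiableAt_const b)
  have h1 : fderiv ℝ Ω u a b c = - fderiv ℝ Ω u a c b := by
    rw [← fderiv_clm_apply_const hΩ, ← fderiv_clm_apply_const (hΩb b),
      ← fderiv_clm_apply_const hΩ, ← fderiv_clm_apply_const (hΩb c), ← neg_apply, ← fderiv_fun_neg]
    congr 1
    apply Filter.EventuallyEq.fderiv_eq
    filter_upwards [hG.mem_nhds hu] with y hy
    rw [h.form_eq y hy, h.form_eq y hy, h.adjoint_J hy, hG.symm y hy c]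
  rw [h.fderiv_Ω hu, h.fderiv_Ω hu] at h1
  have h2 := h.adjoint_J hu (chris G u a b) c
  have h3 := h.adjoint_J hu (chris G u a c) b
  rw [hG.symm u hu _ c] at h2
  rw [hG.symm u hu _ b] at h3
  linarith

/-- The deviation from the quasi-Kähler condition in terms of the Lee form. -/
lemma nablaJ_diag (h : IsLeeOn G J Ω θ B U) (hu : u ∈ U) (v : E) :
    J u (nablaJ G J u v v) + nablaJ G J u (J u v) v =
      θ u v • v + θ u (J u v) • J u v - G u v v • B u := by
  have hG := h.metric
  refine hG.ext_inner hu fun z => ?_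
  -- With the entries `v, Jv, z`, the term of `dΩ` in which `J` is differentiated along `z` drops
  -- out (`e2`): `∇_z J` is skew and anticommutes with `J`. The other two are the pairing of the
  -- left side with `z`.
  have hd := h.dOmega u hu v (J u v) z
  have e1 : dTwo Ω u v (J u v) z = G u (J u v) (nablaJ G J u v z)
      - G u v (nablaJ G J u (J u v) z) + G u v (nablaJ G J u z (J u v)) := by
    have s1 := h.adjoint_J hu (chris G u v z) (J u v)
    have s2 := h.adjoint_J hu (chris G u (J u v) z) v
    have s3 := h.adjoint_J hu (chris G u v (J u v)) z
    have t1 := hG.symm u hu (J u (chris G u v z)) (J u v)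
    have t2 := hG.symm u hu (J u (chris G u (J u v) z)) v
    have t3 := hG.symm u hu (J u (chris G u v (J u v))) z
    have r := h.adjoint_J hu z (chris G u v (J u v))
    rw [dTwo, h.fderiv_Ω hu, h.fderiv_Ω hu, h.fderiv_Ω hu, hG.chris_symm hu z v,
      hG.chris_symm hu z (J u v), hG.chris_symm hu (J u v) v]
    linarith
  have e2 : G u v (nablaJ G J u z (J u v)) = 0 := by
    have := h.nablaJ_skew hu z v (J u v)
    rw [h.nablaJ_apply_J hu, map_neg, h.adjoint_J hu] at this ⊢
    linarith
  have e3 : G u (J u v) (nablaJ G J u v z) = G u z (J u (nablaJ G J u v v)) := by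
    rw [h.nablaJ_skew hu, h.nablaJ_apply_J hu, map_neg, neg_neg]
  have e4 := h.nablaJ_skew hu (J u v) v z
  rw [e1, e2, e3, e4, wedgeOneTwo, h.form_eq u hu, h.form_eq u hu, h.form_eq u hu,
    h.isometry u hu, h.sq u hu, h.adjoint_J hu v z, map_neg] at hd
  rw [hG.symm u hu _ z, map_add]
  simp only [map_sub, map_add, map_smul, sub_apply, add_apply, smul_apply, smul_eq_mul,
    h.dual u hu]
  linarith

/-- `∇B` is symmetric because `θ` is closed. -/
lemma cov_dual_symm (h : IsLeeOn G J Ω θ B U) (hu : u ∈ U) (a c : E) :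
    G u (cov G B u a) c = G u a (cov G B u c) := by
  have hG := h.metric
  have hθ : DifferentiableAt ℝ θ u :=
    (h.smooth_form.contDiffAt (hG.mem_nhds hu)).differentiableAt (by simp)
  have key : ∀ a c, fderiv ℝ θ u a c = G u (cov G B u a) c + G u (B u) (chris G u a c) := by
    intro a c
    have h1 : (fun y => G y (B y) c) =ᶠ[nhds u] fun y => θ y c := by
      filter_upwards [hG.mem_nhds hu] with y hy using h.dual y hy c
    have h2 : HasFDerivAt (fun y => G y (B y) c) _ u :=
      ((hG.differentiableAt hu).hasFDerivAt.clm_apply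
        (h.differentiableAt_dual hu).hasFDerivAt).clm_apply (hasFDerivAt_const c u)
    rw [← fderiv_clm_apply_const hθ, ← h1.fderiv_eq, h2.fderiv, cov_eq]
    simp [hG.fderiv_eq hu]
    ring
  have h3 := h.closed u hu a c
  rw [dOne, key, key, hG.chris_symm hu c a] at h3
  rw [hG.symm u hu a]
  linarith

end IsLeeOn

/-! ### Holomorphic maps into quasi-Kähler targets: tension and bitension. -/

/-- `f` is a holomorphic map from `(U, G, J)`, with Lee form `θ`, to the quasi-Kähler
`(V, H, J')`. -/
structure IsHolomorphicOn (G : E → E →L[ℝ] E →L[ℝ] ℝ) (J : E → E →L[ℝ] E)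
    (Ω : E → E →L[ℝ] E →L[ℝ] ℝ) (θ : E → E →L[ℝ] ℝ) (B : E → E) (U : Set E)
    (H : F → F →L[ℝ] F →L[ℝ] ℝ) (J' : F → F →L[ℝ] F) (V : Set F) (f : E → F) : Prop where
  source : IsLeeOn G J Ω θ B U
  target : IsAlmostComplexOn H J' V
  quasiKahler : ∀ v ∈ V, ∀ a b : F, nablaJ H J' v a b + nablaJ H J' v (J' v a) (J' v b) = 0
  smooth : ContDiffOn ℝ ∞ f U
  mapsTo : Set.MapsTo f U V
  comm : ∀ u ∈ U, ∀ a : E, fderiv ℝ f u (J u a) = J' (f u) (fderiv ℝ f u a)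

variable {H : F → F →L[ℝ] F →L[ℝ] ℝ} {J' : F → F →L[ℝ] F} {V : Set F} {f : E → F}

lemma curv_smul (G : E → E →L[ℝ] E →L[ℝ] ℝ) (c : ℝ) (u a b v : E) :
    curv G u (c • a) b v = c • curv G u a b v := by
  have h1 : (fun y => christoffel G y (c • a) v) = fun y => c • christoffel G y a v :=
    funext fun y => christoffel_smul_left G c y a v
  have h2 : fderiv ℝ (fun y => c • christoffel G y a v) u =
      c • fderiv ℝ (fun y => christoffel G y a v) u :=
    congrFun (fderiv_const_smul_field (𝕜 := ℝ) (f := fun y => christoffel G y a v) c) u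
  simp only [curv, cov_eq, h1, h2, map_smul, smul_apply, smul_sub, smul_add]

namespace IsHolomorphicOn

lemma isMapOn (h : IsHolomorphicOn G J Ω θ B U H J' V f) : IsMapOn G H f U V :=
  ⟨h.source.metric, h.target.metric, h.smooth, h.mapsTo⟩

/-- Obtained by differentiating `df(Jb) = J'(df b)` along `a`, an identity valid on a neighbourhood
of `u`. -/
lemma sff_apply_J (h : IsHolomorphicOn G J Ω θ B U H J' V f) (hu : u ∈ U) (a b : E) :
    sff G H f u a (J u b) = nablaJ H J' (f u) (fderiv ℝ f u a) (fderiv ℝ f u b)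
      + J' (f u) (sff G H f u a b) - fderiv ℝ f u (nablaJ G J u a b) := by
  have hf := h.isMapOn
  have hJ := h.source.differentiableAt hu
  have hJ' := h.target.differentiableAt (h.mapsTo hu)
  have hD := hf.differentiableAt_fderiv hu
  have h1 : fderiv ℝ (fun y => fderiv ℝ f y (J y b)) u a =
      fderiv ℝ (fun y => J' (f y) (fderiv ℝ f y b)) u a := by
    congr 1
    apply Filter.EventuallyEq.fderiv_eq
    filter_upwards [h.source.metric.mem_nhds hu] with y hy using h.comm y hy b
  have h2 : HasFDerivAt (fun y => J' (f y)) ((fderiv ℝ J' (f u)).comp (fderiv ℝ f u)) u :=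
    hJ'.hasFDerivAt.comp u (hf.differentiableAt hu).hasFDerivAt
  have h3 := h2.clm_apply (hD.hasFDerivAt.clm_apply (hasFDerivAt_const b u))
  rw [fderiv_clm_apply_apply hD (hJ.clm_apply (differentiableAt_const b)),
    fderiv_clm_apply_const hJ, h3.fderiv] at h1
  simp only [add_apply, ContinuousLinearMap.comp_apply, ContinuousLinearMap.flip_apply,
    zero_apply, map_zero, zero_add] at h1
  rw [sff_apply, sff_apply, h.target.nablaJ_eq (h.mapsTo hu), h.source.nablaJ_eq hu,
    h.comm u hu, eq_sub_of_add_eq h1]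
  simp only [map_add, map_sub, h.comm u hu]
  abel

/-- Two uses of `sff_apply_J` make the terms `∇df(a, a)` cancel. The target terms vanish by the
quasi-Kähler condition, and the source terms are evaluated by the Lee form. -/
lemma sff_diag (h : IsHolomorphicOn G J Ω θ B U H J' V f) (hu : u ∈ U) (a : E) :
    sff G H f u a a + sff G H f u (J u a) (J u a) =
      fderiv ℝ f u (G u a a • B u - θ u a • a - θ u (J u a) • J u a) := by
  have h1 : G u a a • B u - θ u a • a - θ u (J u a) • J u a =
      - (J u (nablaJ G J u a a) + nablaJ G J u (J u a) a) := by
    rw [h.source.nablaJ_diag hu]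
    abel
  have h2 := h.target.nablaJ_diag (h.mapsTo hu) (h.quasiKahler _ (h.mapsTo hu)) (fderiv ℝ f u a)
  rw [h1, h.sff_apply_J hu (J u a) a, h.isMapOn.sff_symm hu (J u a) a, h.sff_apply_J hu a a,
    h.comm u hu, eq_neg_of_add_eq_zero_left h2]
  simp only [map_add, map_sub, map_neg, h.comm u hu, h.target.sq _ (h.mapsTo hu)]
  abel

/-- The part of `∇df` that is invariant under the complex structure is determined by the
Lee form. -/
lemma sff_add_sff_J (h : IsHolomorphicOn G J Ω θ B U H J' V f) (hu : u ∈ U) (a b : E) :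
    sff G H f u a b + sff G H f u (J u a) (J u b) =
      fderiv ℝ f u (G u a b • B u - (1 / 2 : ℝ) •
        (θ u a • b + θ u b • a + θ u (J u a) • J u b + θ u (J u b) • J u a)) := by
  have h1 := h.sff_diag hu (a + b)
  have h2 := h.sff_diag hu a
  have h3 := h.sff_diag hu b
  have h4 := h.isMapOn.sff_symm hu b a
  have h5 := h.isMapOn.sff_symm hu (J u b) (J u a)
  have h6 := h.source.metric.symm u hu b a
  simp only [map_add, map_sub, map_smul, add_apply, h4, h5, h6] at h1 h2 h3 ⊢
  -- Polarisation of `sff_diag` over `a + b`, `a` and `b`.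
  have h7 : (2 : ℝ) • (sff G H f u a b + sff G H f u (J u a) (J u b)) =
      (sff G H f u a a + sff G H f u a b + (sff G H f u a b + sff G H f u b b) +
        (sff G H f u (J u a) (J u a) + sff G H f u (J u a) (J u b) +
        (sff G H f u (J u a) (J u b) + sff G H f u (J u b) (J u b)))) -
      (sff G H f u a a + sff G H f u (J u a) (J u a)) -
      (sff G H f u b b + sff G H f u (J u b) (J u b)) := by
    module
  rw [h1, h2, h3] at h7
  have h8 : sff G H f u a b + sff G H f u (J u a) (J u b) =
    (1 / 2 : ℝ) • (2 : ℝ) • (sff G H f u a b + sff G H f u (J u a) (J u b)) := by module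
  rw [h8, h7]
  module

/-- Trace of the `J`-invariant part of `∇df`, paired with a symmetric endomorphism `P`. -/
lemma metricTrace_sff_add (h : IsHolomorphicOn G J Ω θ B U H J' V f) (hu : u ∈ U)
    {P : E →L[ℝ] E} (hP : ∀ a c, G u (P a) c = G u a (P c)) :
    metricTrace (G u) (fun a b => sff G H f u a (P b) + sff G H f u (J u a) (J u (P b))) =
      fderiv ℝ f u (metricTrace (G u) (fun a b => G u a (P b)) • B u - P (B u)
        + J u (P (J u (B u)))) := by
  have hG := h.source.metric
  have hs := h.source
  have t0 : metricTrace (G u) (fun a b => G u a (P b) • B u) =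
      metricTrace (G u) (fun a b => G u a (P b)) • B u := by
    simp only [metricTrace, Finset.sum_smul]
  have t1 : metricTrace (G u) (fun a b => θ u a • P b) = P (B u) :=
    hG.metricTrace_smul_right hu (hs.dual u hu) P
  have t2 : metricTrace (G u) (fun a b => θ u (P b) • a) = P (B u) :=
    hG.metricTrace_smul_left hu (α := fun w => θ u (P w)) (v := P (B u))
      (fun w => by rw [hP, hs.dual u hu]) (ContinuousLinearMap.id ℝ E)
  have hJB : ∀ w, G u (-J u (B u)) w = θ u (J u w) := fun w => by
    rw [← hs.dual u hu, hs.adjoint_J hu, map_neg, neg_apply]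
  have t3 : metricTrace (G u) (fun a b => θ u (J u a) • J u (P b)) =
      J u (P (-J u (B u))) :=
    hG.metricTrace_smul_right hu (α := fun w => θ u (J u w)) hJB ((J u).comp P)
  have t4 : metricTrace (G u) (fun a b => θ u (J u (P b)) • J u a) =
      J u (P (-J u (B u))) :=
    hG.metricTrace_smul_left hu (α := fun w => θ u (J u (P w))) (v := P (-J u (B u)))
      (fun w => by rw [hP, hJB]) (J u)
  have key : (fun a b => sff G H f u a (P b) + sff G H f u (J u a) (J u (P b))) =
      fun a b => fderiv ℝ f u (G u a (P b) • B u - (1 / 2 : ℝ) •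
        (θ u a • P b + θ u (P b) • a + θ u (J u a) • J u (P b) + θ u (J u (P b)) • J u a)) := by
    funext a b
    exact h.sff_add_sff_J hu a (P b)
  rw [key, metricTrace_map, metricTrace_sub, metricTrace_smul, metricTrace_add, metricTrace_add,
    metricTrace_add, t0, t1, t2, t3, t4]
  congr 1
  simp only [map_neg]
  module

/-- `J` is skew, so moving it from the first slot to the second costs a sign. -/
lemma metricTrace_J (h : IsHolomorphicOn G J Ω θ B U H J' V f) (hu : u ∈ U)
    (P : E →L[ℝ] E) :
    metricTrace (G u) (fun a b => sff G H f u (J u a) (J u (P b))) =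
      - metricTrace (G u) (fun a b => sff G H f u a (J u (P (J u b)))) := by
  have hadj : ∀ v w, G u ((-J u) v) w = G u v (J u w) := fun v w => by
    rw [h.source.adjoint_J hu, neg_apply, map_neg, neg_apply]
  have := h.source.metric.metricTrace_adjoint hu hadj
    ((sff G H f u).flip.comp ((J u).comp P)).flip
  simp only [ContinuousLinearMap.flip_apply, ContinuousLinearMap.comp_apply, neg_apply,
    map_neg] at this
  rw [← this, metricTrace, metricTrace, ← Finset.sum_neg_distrib]
  simp

/-- The tension field of a holomorphic map into a quasi-Kähler manifold. -/
lemma tension_eq (h : IsHolomorphicOn G J Ω θ B U H J' V f) (hu : u ∈ U) :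
    tension G H f u = (((Module.finrank ℝ E : ℝ) - 2) / 2) • fderiv ℝ f u (B u) := by
  -- For `P = id` the two traces in the `J`-invariant sum coincide, which gives `2τ = df(mB - B +
  -- J²B)`.
  have h1 := h.metricTrace_sff_add hu (P := ContinuousLinearMap.id ℝ E) (fun _ _ => rfl)
  have h2 := h.metricTrace_J hu (ContinuousLinearMap.id ℝ E)
  have h3 : metricTrace (G u) (fun a b => sff G H f u a (-b)) =
      - metricTrace (G u) (fun a b => sff G H f u a b) := by
    simp [metricTrace]
  simp only [ContinuousLinearMap.id_apply, h.source.sq u hu, metricTrace_add,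
    h.source.metric.metricTrace_self hu] at h1 h2
  rw [h2, h3, neg_neg, ← h.isMapOn.tension_eq hu] at h1
  have h4 : tension G H f u = (1 / 2 : ℝ) • (tension G H f u + tension G H f u) := by module
  rw [h4, h1]
  simp only [map_add, map_sub, map_smul, map_neg]
  module

/-- The vanishing of the bitension field. -/
theorem bitension_eq_zero (h : IsHolomorphicOn G J Ω θ B U H J' V f) (hu : u ∈ U) {m : ℝ}
    (hm : m = Module.finrank ℝ E)
    (h₁ : ∀ X Y, G u (cov G B u X) Y - G u (cov G B u (J u X)) (J u Y) =
      ((2 - m) / 4) * (θ u X * θ u Y - θ u (J u X) * θ u (J u Y)))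
    (h₂ : roughLaplacian G B u + ricci G u (B u) + ((m - 6) / 2) • cov G B u (B u)
      + (divergence G B u - ((m - 2) / 4) * G u (B u) (B u)) • B u = 0) :
    bitension G H f u = 0 := by
  have hf := h.isMapOn
  have hs := h.source
  have hG := hs.metric
  obtain ⟨P, hP⟩ : ∃ P : E →L[ℝ] E, ∀ a, cov G B u a = P a :=
    ⟨fderiv ℝ B u + (chris G u).flip (B u), fun a => rfl⟩
  have hPs : ∀ a c, G u (P a) c = G u a (P c) := fun a c => by
    rw [← hP, ← hP, hs.cov_dual_symm hu]
  simp only [hP] at h₁ h₂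
  set c : ℝ := (m - 2) / 2 with hc
  have hJB : ∀ w, θ u (J u w) = - G u (J u (B u)) w := fun w => by
    rw [← hs.dual u hu, hs.adjoint_J hu]
  have hJB0 : θ u (J u (B u)) = 0 := by
    have := hJB (B u)
    rw [hG.symm u hu, hs.dual u hu] at this
    linarith
  -- The first hypothesis with its second argument dualised, using that `J` is skew.
  have hPJ : ∀ a, P a = - J u (P (J u a)) +
      ((2 - m) / 4) • (θ u a • B u + θ u (J u a) • J u (B u)) := by
    intro a
    refine hG.ext_inner hu fun z => ?_
    have e1 := h₁ a z
    rw [hs.adjoint_J hu, hJB z] at e1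
    simp only [map_add, map_neg, map_smul, add_apply, neg_apply, smul_apply, smul_eq_mul,
      hs.dual u hu]
    linarith
  have hdiv : divergence G B u = metricTrace (G u) (fun a b => G u a (P b)) := by
    simp only [divergence, hP, hPs]
  -- the tension field near `u`
  have hτ : ∀ y ∈ U, tension G H f y = c • fderiv ℝ f y (B y) := fun y hy => by
    rw [h.tension_eq hy, hc, hm]
  have hDB : ∀ y ∈ U, DifferentiableAt ℝ (fun z => fderiv ℝ f z (B z)) y := fun y hy =>
    (hf.differentiableAt_fderiv hy).clm_apply (hs.differentiableAt_dual hy)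
  have hcovτ : ∀ y ∈ U, ∀ a, covAlong H f (tension G H f) y a =
      c • covAlong H f (fun z => fderiv ℝ f z (B z)) y a := fun y hy a => by
    rw [← covAlong_const_smul (hDB y hy)]
    apply covAlong_congr
    filter_upwards [hG.mem_nhds hy] with z hz using hτ z hz
  have hΔ : roughLaplacianAlong G H f (tension G H f) u =
      c • roughLaplacianAlong G H f (fun y => fderiv ℝ f y (B y)) u := by
    rw [roughLaplacianAlong, roughLaplacianAlong, ← metricTrace_smul]
    congr 1
    funext a b
    have hd : DifferentiableAt ℝ (fun y => covAlong H f (fun z => fderiv ℝ f z (B z)) y b) u := by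
      have : ContDiffOn ℝ ∞ (fun y => covAlong H f (fun z => fderiv ℝ f z (B z)) y b) U := by
        have hΨ : ContDiffOn ℝ ∞ (fun z => fderiv ℝ f z (B z)) U :=
          hf.contDiffOn_fderiv.clm_apply hs.smooth_dual
        exact ((hΨ.fderiv_of_isOpen hG.isOpen (by simp)).clm_apply contDiffOn_const).add
          (((hf.target.contDiffOn_chris.comp hf.smooth hf.mapsTo).clm_apply
            (hf.contDiffOn_fderiv.clm_apply contDiffOn_const)).clm_apply hΨ)
      exact (this.contDiffAt (hG.mem_nhds hu)).differentiableAt (by simp)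
    rw [smul_sub, ← hcovτ u hu, ← covAlong_const_smul hd]
    congr 1
    apply covAlong_congr
    filter_upwards [hG.mem_nhds hu] with z hz using hcovτ z hz b
  have hRic : ricciAlong G H f u (tension G H f u) =
      c • ricciAlong G H f u (fderiv ℝ f u (B u)) := by
    rw [ricciAlong, ricciAlong, ← metricTrace_smul, hτ u hu]
    simp only [curv_smul]
  -- the trace of `∇df` against `∇B`
  have htr : metricTrace (G u) (fun a b => sff G H f u a (P b)) =
      metricTrace (G u) (fun a b => sff G H f u (J u a) (J u (P b))) +
        ((2 - m) / 4) • (sff G H f u (B u) (B u) - sff G H f u (J u (B u)) (J u (B u))) := by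
    have t1 : metricTrace (G u) (fun a b => θ u b • sff G H f u a (B u)) =
        sff G H f u (B u) (B u) :=
      hG.metricTrace_smul_left hu (hs.dual u hu) ((sff G H f u).flip (B u))
    have t2 : metricTrace (G u) (fun a b => θ u (J u b) • sff G H f u a (J u (B u))) =
        sff G H f u (-J u (B u)) (J u (B u)) :=
      hG.metricTrace_smul_left hu (α := fun w => θ u (J u w)) (v := -J u (B u))
        (fun w => by rw [hJB, map_neg, neg_apply]) ((sff G H f u).flip (J u (B u)))
    have key : (fun a b => sff G H f u a (P b)) = fun a b =>
        (-1 : ℝ) • sff G H f u a (J u (P (J u b))) + ((2 - m) / 4) •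
          (θ u b • sff G H f u a (B u) + θ u (J u b) • sff G H f u a (J u (B u))) := by
      funext a b
      conv_lhs => rw [hPJ b]
      simp only [map_add, map_neg, map_smul]
      module
    rw [h.metricTrace_J hu, key, metricTrace_add, metricTrace_smul, metricTrace_smul,
      metricTrace_add, t1, t2, map_neg, neg_apply]
    module
  have hsum := h.metricTrace_sff_add hu hPs
  rw [metricTrace_add, ← hdiv] at hsum
  have hBB := h.sff_add_sff_J hu (B u) (B u)
  rw [hJB0, hs.dual u hu] at hBB
  -- At `a = b = B` the Lee form expression is `|B|²B - θ(B)B = 0`, as `θ(JB) = 0`.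
  have hBB' : sff G H f u (J u (B u)) (J u (B u)) = - sff G H f u (B u) (B u) := by
    rw [eq_neg_iff_add_eq_zero, add_comm, hBB]
    have : θ u (B u) • B u - (1 / 2 : ℝ) • (θ u (B u) • B u + θ u (B u) • B u +
      (0 : ℝ) • J u (B u) + (0 : ℝ) • J u (B u)) = 0 := by module
    rw [this, map_zero]
  have hPB : J u (P (J u (B u))) = ((2 - m) / 4) • (θ u (B u) • B u) - P (B u) := by
    have := hPJ (B u)
    rw [hJB0] at this
    rw [this]
    module
  have hjac := hf.jacobi_fderiv hu hs.smooth_dual P hP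
  rw [hcovτ u hu, hf.covAlong_fderiv hu (hs.differentiableAt_dual hu), hP] at hjac
  have hL : roughLaplacian G B u + ricci G u (B u) =
      - (((m - 6) / 2) • P (B u) +
        (divergence G B u - ((m - 2) / 4) * θ u (B u)) • B u) := by
    rw [hs.dual u hu] at h₂
    rw [eq_neg_iff_add_eq_zero, ← add_assoc]
    exact h₂
  rw [bitension, hΔ, hRic, ← smul_add, hjac, hL]
  -- `2A = (A + A') + (A - A')`, with the sum from `hsum` and the difference from `htr`.
  have h2tr : (2 : ℝ) • metricTrace (G u) (fun a b => sff G H f u a (P b)) =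
      fderiv ℝ f u (divergence G B u • B u - P (B u) + J u (P (J u (B u)))) +
      ((2 - m) / 4) • (sff G H f u (B u) (B u) - sff G H f u (J u (B u)) (J u (B u))) := by
    rw [← hsum, two_smul]
    nth_rewrite 2 [htr]
    abel
  -- The terms `∇df(B, B)` now cancel. `PB` has coefficient `c - 2 = (m - 6)/2`, and `|B|²B` has `(2
  -- - m)/4` from `JPJB`, which match `hL`.
  rw [h2tr, hBB', hPB, hc]
  simp only [map_add, map_sub, map_neg, map_smul]
  module

end IsHolomorphicOn

end Coord

/-! ### Transfer from the manifolds to charts. -/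

namespace AH

variable {E : Type*} [NormedAddCommGroup E] [NormedSpace ℝ E]
  {M : Type*} [TopologicalSpace M] [ChartedSpace E M] [IsManifold 𝓘(ℝ, E) ∞ M]
  {F : Type*} [NormedAddCommGroup F] [NormedSpace ℝ F]
  {N : Type*} [TopologicalSpace N] [ChartedSpace F N] [IsManifold 𝓘(ℝ, F) ∞ N]

lemma isInvertible_chartDiff {p x : M} (hx : x ∈ (extChartAt 𝓘(ℝ, E) p).source) :
    (chartDiff p x : TangentSpace 𝓘(ℝ, E) x →L[ℝ] E).IsInvertible :=
  have : IsManifold 𝓘(ℝ, E) 1 M := IsManifold.of_le (n := ∞) (by simp)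
  isInvertible_mfderiv_extChartAt hx

lemma chartDiff_chartFrame {p x : M} (hx : x ∈ (extChartAt 𝓘(ℝ, E) p).source) (a : E) :
    chartDiff p x (chartFrame p x a) = a :=
  ((isInvertible_chartDiff hx).inverse_apply_eq.1 rfl).symm

lemma chartFrame_chartDiff {p x : M} (hx : x ∈ (extChartAt 𝓘(ℝ, E) p).source)
    (v : TangentSpace 𝓘(ℝ, E) x) : chartFrame p x (chartDiff p x v) = v :=
  (isInvertible_chartDiff hx).inverse_apply_eq.2 rfl

/-- Identifies the bundle trivialisation with the chart differential, so that smoothness of sections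
becomes smoothness of chart components. -/
lemma trivializationAt_snd {p x : M} (hx : x ∈ (extChartAt 𝓘(ℝ, E) p).source)
    (v : TangentSpace 𝓘(ℝ, E) x) :
    (trivializationAt E (TangentSpace 𝓘(ℝ, E) : M → Type _) p ⟨x, v⟩).2 = chartDiff p x v := by
  have : IsManifold 𝓘(ℝ, E) 1 M := IsManifold.of_le (n := ∞) (by simp)
  rw [extChartAt_source] at hx
  rw [chartDiff, ← TangentBundle.continuousLinearMapAt_trivializationAt hx,
    Trivialization.continuousLinearMapAt_apply, Trivialization.coe_linearMapAt_of_mem]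
  simpa using hx

/-- A coordinate field is constant in the trivialisation at `p`. -/
lemma contMDiffOn_chartFrame (p : M) (a : E) :
    ContMDiffOn 𝓘(ℝ, E) (𝓘(ℝ, E).prod 𝓘(ℝ, E)) ∞
      (fun x => TotalSpace.mk' E (E := (TangentSpace 𝓘(ℝ, E) : M → Type _)) x (chartFrame p x a))
      (extChartAt 𝓘(ℝ, E) p).source := by
  rw [Trivialization.contMDiffOn_section_iff
    (trivializationAt E (TangentSpace 𝓘(ℝ, E) : M → Type _) p) (isOpen_extChartAt_source p)
    (by simp)]
  refine (contMDiffOn_const (c := a)).congr fun x hx => ?_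
  rw [trivializationAt_snd hx, chartDiff_chartFrame hx]

variable {p : M} {u : E}

lemma symm_mem (hu : u ∈ (extChartAt 𝓘(ℝ, E) p).target) :
    (extChartAt 𝓘(ℝ, E) p).symm u ∈ (extChartAt 𝓘(ℝ, E) p).source :=
  (extChartAt 𝓘(ℝ, E) p).map_target hu

lemma contDiffOn_comp_symm {f : M → F}
    (hf : ContMDiffOn 𝓘(ℝ, E) 𝓘(ℝ, F) ∞ f (extChartAt 𝓘(ℝ, E) p).source) :
    ContDiffOn ℝ ∞ (fun u => f ((extChartAt 𝓘(ℝ, E) p).symm u)) (extChartAt 𝓘(ℝ, E) p).target :=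
  (hf.comp (contMDiffOn_extChartAt_symm p) fun _ hu => symm_mem hu).contDiffOn

lemma locBilin_apply (b : ∀ x : M, TangentSpace 𝓘(ℝ, E) x →L[ℝ] TangentSpace 𝓘(ℝ, E) x →L[ℝ] ℝ)
    (v w : E) :
    locBilin p b u v w = b ((extChartAt 𝓘(ℝ, E) p).symm u)
      (chartFrame p _ v) (chartFrame p _ w) := rfl

lemma locForm_apply (θ : ∀ x : M, TangentSpace 𝓘(ℝ, E) x →L[ℝ] ℝ) (v : E) :
    locForm p θ u v = θ ((extChartAt 𝓘(ℝ, E) p).symm u) (chartFrame p _ v) := rfl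

lemma locEndo_apply (J : ∀ x : M, TangentSpace 𝓘(ℝ, E) x →L[ℝ] TangentSpace 𝓘(ℝ, E) x) (v : E) :
    locEndo p J u v = chartDiff p _ (J ((extChartAt 𝓘(ℝ, E) p).symm u) (chartFrame p _ v)) := rfl

lemma locVec_apply (V : ∀ x : M, TangentSpace 𝓘(ℝ, E) x) :
    locVec p V u = chartDiff p _ (V ((extChartAt 𝓘(ℝ, E) p).symm u)) := rfl

lemma chartFrame_locEndo (hu : u ∈ (extChartAt 𝓘(ℝ, E) p).target)
    (J : ∀ x : M, TangentSpace 𝓘(ℝ, E) x →L[ℝ] TangentSpace 𝓘(ℝ, E) x) (v : E) :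
    chartFrame p ((extChartAt 𝓘(ℝ, E) p).symm u) (locEndo p J u v) =
      J _ (chartFrame p _ v) := by
  rw [locEndo_apply, chartFrame_chartDiff (symm_mem hu)]

variable [FiniteDimensional ℝ E]

lemma contDiffOn_locBilin
    {b : ∀ x : M, TangentSpace 𝓘(ℝ, E) x →L[ℝ] TangentSpace 𝓘(ℝ, E) x →L[ℝ] ℝ}
    (hb : ∀ v w : E, ContMDiffOn 𝓘(ℝ, E) 𝓘(ℝ, ℝ) ∞
      (fun x => b x (chartFrame p x v) (chartFrame p x w)) (extChartAt 𝓘(ℝ, E) p).source) :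
    ContDiffOn ℝ ∞ (locBilin p b) (extChartAt 𝓘(ℝ, E) p).target := by
  rw [contDiffOn_clm_apply]
  intro v
  rw [contDiffOn_clm_apply]
  exact fun w => contDiffOn_comp_symm (hb v w)

section Hermitian

variable
  {g : ContMDiffRiemannianMetric 𝓘(ℝ, E) ∞ E (TangentSpace 𝓘(ℝ, E) : M → Type _)}
  {J : ∀ x : M, TangentSpace 𝓘(ℝ, E) x →L[ℝ] TangentSpace 𝓘(ℝ, E) x}
  {θ : ∀ x : M, TangentSpace 𝓘(ℝ, E) x →L[ℝ] ℝ}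

lemma contMDiffOn_inner {X Y : ∀ x : M, TangentSpace 𝓘(ℝ, E) x} {s : Set M}
    (hX : ContMDiffOn 𝓘(ℝ, E) (𝓘(ℝ, E).prod 𝓘(ℝ, E)) ∞
      (fun x => TotalSpace.mk' E (E := (TangentSpace 𝓘(ℝ, E) : M → Type _)) x (X x)) s)
    (hY : ContMDiffOn 𝓘(ℝ, E) (𝓘(ℝ, E).prod 𝓘(ℝ, E)) ∞
      (fun x => TotalSpace.mk' E (E := (TangentSpace 𝓘(ℝ, E) : M → Type _)) x (Y x)) s) :
    ContMDiffOn 𝓘(ℝ, E) 𝓘(ℝ, ℝ) ∞ (fun x => g.inner x (X x) (Y x)) s := by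
  have h := ContMDiffOn.clm_bundle_apply₂ (F₁ := E) (F₂ := E) (F₃ := ℝ)
    (E₃ := fun _ : M => ℝ) (g.contMDiff.contMDiffOn (s := s)) hX hY
  intro x hx
  have := h x hx
  rw [contMDiffWithinAt_totalSpace] at this
  exact this.2

lemma contMDiffOn_endo (hJ : IsAlmostHermitian g J) {X : ∀ x : M, TangentSpace 𝓘(ℝ, E) x}
    {s : Set M} (hX : ContMDiffOn 𝓘(ℝ, E) (𝓘(ℝ, E).prod 𝓘(ℝ, E)) ∞
      (fun x => TotalSpace.mk' E (E := (TangentSpace 𝓘(ℝ, E) : M → Type _)) x (X x)) s) :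
    ContMDiffOn 𝓘(ℝ, E) (𝓘(ℝ, E).prod 𝓘(ℝ, E)) ∞
      (fun x => TotalSpace.mk' E (E := (TangentSpace 𝓘(ℝ, E) : M → Type _)) x (J x (X x))) s :=
  ContMDiffOn.clm_bundle_apply (hJ.smooth.contMDiffOn (s := s)) hX

variable (g) in
lemma isMetricOn (p : M) : Coord.IsMetricOn (locBilin p g.inner) (extChartAt 𝓘(ℝ, E) p).target where
  isOpen := isOpen_extChartAt_target p
  smooth := contDiffOn_locBilin fun v w =>
    contMDiffOn_inner (contMDiffOn_chartFrame p v) (contMDiffOn_chartFrame p w)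
  symm _ _ v w := g.symm _ _ _
  pos u hu v hv := by
    refine g.pos _ _ fun h => hv ?_
    exact (chartDiff_chartFrame (symm_mem hu) v).symm.trans
      ((congrArg (chartDiff p _) h).trans (map_zero _))

lemma isAlmostComplexOn (hJ : IsAlmostHermitian g J) (p : M) :
    Coord.IsAlmostComplexOn (locBilin p g.inner) (locEndo p J) (extChartAt 𝓘(ℝ, E) p).target where
  metric := isMetricOn g p
  smooth := by
    rw [contDiffOn_clm_apply]
    intro v
    have h := contMDiffOn_endo hJ (contMDiffOn_chartFrame p v)
    rw [Trivialization.contMDiffOn_section_iff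
      (trivializationAt E (TangentSpace 𝓘(ℝ, E) : M → Type _) p) (isOpen_extChartAt_source p)
      (by simp)] at h
    exact contDiffOn_comp_symm (h.congr fun x hx => (trivializationAt_snd hx _).symm)
  sq u hu v := by
    rw [locEndo_apply, chartFrame_locEndo hu, hJ.sq_eq_neg, map_neg,
      chartDiff_chartFrame (symm_mem hu)]

lemma isLeeOn (hJ : IsAlmostHermitian g J) (hθ : IsLeeForm g J θ)
    {B : ∀ x : M, TangentSpace 𝓘(ℝ, E) x}
    (hB : ∀ (x : M) (v : TangentSpace 𝓘(ℝ, E) x), g.inner x (B x) v = θ x v) (p : M) :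
    Coord.IsLeeOn (locBilin p g.inner) (locEndo p J) (locBilin p (fundForm g.inner J))
      (locForm p θ) (locVec p B) (extChartAt 𝓘(ℝ, E) p).target where
  toIsAlmostComplexOn := isAlmostComplexOn hJ p
  isometry u hu v w := by
    rw [locBilin_apply, chartFrame_locEndo hu, chartFrame_locEndo hu, hJ.isometry]
    rfl
  smooth_form := by
    rw [contDiffOn_clm_apply]
    intro v
    have h := ContMDiffOn.clm_bundle_apply (F₁ := E) (F₂ := ℝ) (E₂ := Trivial M ℝ)
      (hθ.smooth.contMDiffOn (s := (extChartAt 𝓘(ℝ, E) p).source)) (contMDiffOn_chartFrame p v)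
    refine contDiffOn_comp_symm (f := fun x => θ x (chartFrame p x v)) fun x hx => ?_
    have := h x hx
    rw [contMDiffWithinAt_totalSpace] at this
    exact this.2
  closed := hθ.closed p
  form_eq u hu v w := by
    rw [locBilin_apply, locBilin_apply, chartFrame_locEndo hu]
    rfl
  smooth_Ω := contDiffOn_locBilin fun v w => contMDiffOn_inner
    (contMDiffOn_chartFrame p v) (contMDiffOn_endo hJ (contMDiffOn_chartFrame p w))
  dOmega := hθ.dOmega p
  dual u hu v := by
    rw [locBilin_apply, locVec_apply, chartFrame_chartDiff (symm_mem hu), hB]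
    rfl

end Hermitian

/-- The coordinate domain on which a map is described in the charts at `p` and `φ p`. -/
def mapDomain (E : Type*) [NormedAddCommGroup E] [NormedSpace ℝ E] [ChartedSpace E M]
    (F : Type*) [NormedAddCommGroup F] [NormedSpace ℝ F] [ChartedSpace F N]
    (φ : M → N) (p : M) : Set E :=
  (extChartAt 𝓘(ℝ, E) p).target ∩
    (extChartAt 𝓘(ℝ, E) p).symm ⁻¹' (φ ⁻¹' (extChartAt 𝓘(ℝ, F) (φ p)).source)

variable {φ : M → N}

lemma isOpen_mapDomain (hφ : Continuous φ) (p : M) : IsOpen (mapDomain E F φ p) :=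
  (continuousOn_extChartAt_symm p).isOpen_inter_preimage (isOpen_extChartAt_target p)
    ((isOpen_extChartAt_source (φ p)).preimage hφ)

lemma contDiffOn_locMap (hφ : ContMDiff 𝓘(ℝ, E) 𝓘(ℝ, F) ∞ φ) (p : M) :
    ContDiffOn ℝ ∞ (locMap φ p : E → F) (mapDomain E F φ p) := by
  have h1 : ContMDiffOn 𝓘(ℝ, E) 𝓘(ℝ, E) ∞ (extChartAt 𝓘(ℝ, E) p).symm (mapDomain E F φ p) :=
    (contMDiffOn_extChartAt_symm p).mono Set.inter_subset_left
  have h2 : ContMDiffOn 𝓘(ℝ, F) 𝓘(ℝ, F) ∞ (extChartAt 𝓘(ℝ, F) (φ p))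
      (extChartAt 𝓘(ℝ, F) (φ p)).source := by
    rw [extChartAt_source]
    exact contMDiffOn_extChartAt
  exact (h2.comp (hφ.comp_contMDiffOn h1) fun u hu => hu.2).contDiffOn

/-- Chain rule for `locMap ∘ chart = chart ∘ φ`, evaluated on the coordinate frame. -/
lemma fderiv_locMap (hφ : ContMDiff 𝓘(ℝ, E) 𝓘(ℝ, F) ∞ φ) {p : M} {u : E}
    (hu : u ∈ mapDomain E F φ p) (a : E) :
    fderiv ℝ (locMap φ p : E → F) u a =
      chartDiff (φ p) (φ ((extChartAt 𝓘(ℝ, E) p).symm u))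
        (mfderiv 𝓘(ℝ, E) 𝓘(ℝ, F) φ ((extChartAt 𝓘(ℝ, E) p).symm u) (chartFrame p _ a)) := by
  have : IsManifold 𝓘(ℝ, E) 1 M := IsManifold.of_le (n := ∞) (by simp)
  have : IsManifold 𝓘(ℝ, F) 1 N := IsManifold.of_le (n := ∞) (by simp)
  set x := (extChartAt 𝓘(ℝ, E) p).symm u with hx
  have hxs : x ∈ (extChartAt 𝓘(ℝ, E) p).source := symm_mem hu.1
  have hux : extChartAt 𝓘(ℝ, E) p x = u := (extChartAt 𝓘(ℝ, E) p).right_inv hu.1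
  have hφx : MDifferentiableAt 𝓘(ℝ, E) 𝓘(ℝ, F) φ x := hφ.mdifferentiableAt (by simp)
  have hcx : MDifferentiableAt 𝓘(ℝ, E) 𝓘(ℝ, E) (extChartAt 𝓘(ℝ, E) p) x :=
    mdifferentiableAt_extChartAt (by simpa using hxs)
  have hcφ : MDifferentiableAt 𝓘(ℝ, F) 𝓘(ℝ, F) (extChartAt 𝓘(ℝ, F) (φ p)) (φ x) :=
    mdifferentiableAt_extChartAt (by rw [← extChartAt_source 𝓘(ℝ, F)]; exact hu.2)
  have hloc : DifferentiableAt ℝ (locMap φ p : E → F) u :=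
    ((contDiffOn_locMap hφ p).contDiffAt
      ((isOpen_mapDomain hφ.continuous p).mem_nhds hu)).differentiableAt (by simp)
  have heq : (locMap φ p : E → F) ∘ extChartAt 𝓘(ℝ, E) p =ᶠ[nhds x]
      extChartAt 𝓘(ℝ, F) (φ p) ∘ φ := by
    filter_upwards [(isOpen_extChartAt_source p).mem_nhds hxs] with y hy
    simp only [Function.comp, locMap, (extChartAt 𝓘(ℝ, E) p).left_inv hy]
  have h1 := heq.mfderiv_eq (I := 𝓘(ℝ, E)) (I' := 𝓘(ℝ, F))
  rw [mfderiv_comp x (I' := 𝓘(ℝ, E)) (by rw [hux]; exact hloc.mdifferentiableAt) hcx,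
    mfderiv_comp x hcφ hφx, mfderiv_eq_fderiv, hux] at h1
  have h2 := congrArg (fun L : TangentSpace 𝓘(ℝ, E) x →L[ℝ] F => L (chartFrame p x a)) h1
  have h3 := chartDiff_chartFrame hxs a
  change fderiv ℝ (locMap φ p : E → F) u (chartDiff p x (chartFrame p x a)) = _ at h2
  rw [h3] at h2
  exact h2

lemma isHolomorphicOn [FiniteDimensional ℝ F]
    {g : ContMDiffRiemannianMetric 𝓘(ℝ, E) ∞ E (TangentSpace 𝓘(ℝ, E) : M → Type _)}
    {J : ∀ x : M, TangentSpace 𝓘(ℝ, E) x →L[ℝ] TangentSpace 𝓘(ℝ, E) x}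
    (hJ : IsAlmostHermitian g J)
    {θ : ∀ x : M, TangentSpace 𝓘(ℝ, E) x →L[ℝ] ℝ} (hθ : IsLeeForm g J θ)
    {B : ∀ x : M, TangentSpace 𝓘(ℝ, E) x}
    (hB : ∀ (x : M) (v : TangentSpace 𝓘(ℝ, E) x), g.inner x (B x) v = θ x v)
    {h : ContMDiffRiemannianMetric 𝓘(ℝ, F) ∞ F (TangentSpace 𝓘(ℝ, F) : N → Type _)}
    {J' : ∀ y : N, TangentSpace 𝓘(ℝ, F) y →L[ℝ] TangentSpace 𝓘(ℝ, F) y}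
    (hN : IsOneTwoSymplectic h J') (hφ : IsHolomorphic J J' φ) (p : M) :
    Coord.IsHolomorphicOn (locBilin p g.inner) (locEndo p J) (locBilin p (fundForm g.inner J))
      (locForm p θ) (locVec p B) (mapDomain E F φ p) (locBilin (φ p) h.inner)
      (locEndo (φ p) J') (extChartAt 𝓘(ℝ, F) (φ p)).target (locMap φ p) where
  source := (isLeeOn hJ hθ hB p).mono (isOpen_mapDomain hφ.smooth.continuous p)
    Set.inter_subset_left
  target := isAlmostComplexOn hN.toIsAlmostHermitian (φ p)
  quasiKahler := hN.quasiKahler (φ p)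
  smooth := contDiffOn_locMap hφ.smooth p
  mapsTo u hu := (extChartAt 𝓘(ℝ, F) (φ p)).map_source hu.2
  comm u hu a := by
    have hl : (extChartAt 𝓘(ℝ, F) (φ p)).symm (locMap φ p u) =
        φ ((extChartAt 𝓘(ℝ, E) p).symm u) := (extChartAt 𝓘(ℝ, F) (φ p)).left_inv hu.2
    rw [fderiv_locMap hφ.smooth hu, fderiv_locMap hφ.smooth hu, chartFrame_locEndo hu.1,
      hφ.comm, locEndo_apply, hl, chartFrame_chartDiff hu.2]

end AH

end

theorem proposition2
    {E : Type*} [NormedAddCommGroup E] [NormedSpace ℝ E] [FiniteDimensional ℝ E]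
    {M : Type*} [TopologicalSpace M] [ChartedSpace E M] [IsManifold 𝓘(ℝ, E) ∞ M]
    (m : ℕ) (hm : m = Module.finrank ℝ E)
    (g : ContMDiffRiemannianMetric 𝓘(ℝ, E) ∞ E (TangentSpace 𝓘(ℝ, E) : M → Type _))
    (J : ∀ x : M, TangentSpace 𝓘(ℝ, E) x →L[ℝ] TangentSpace 𝓘(ℝ, E) x)
    (hlck : AH.IsLCK g J)
    (θ : ∀ x : M, TangentSpace 𝓘(ℝ, E) x →L[ℝ] ℝ) (hθ : AH.IsLeeForm g J θ)
    (B : ∀ x : M, TangentSpace 𝓘(ℝ, E) x)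
    (hB : ∀ (x : M) (v : TangentSpace 𝓘(ℝ, E) x), g.inner x (B x) v = θ x v)
    (h1 : ∀ (x : M) (X Y : TangentSpace 𝓘(ℝ, E) x),
      g.inner x (AH.nabla g B x X) Y - g.inner x (AH.nabla g B x (J x X)) (J x Y) =
        ((2 - (m : ℝ)) / 4) * (θ x X * θ x Y - θ x (J x X) * θ x (J x Y)))
    (h2 : ∀ x : M,
      AH.roughLaplacian g B x + AH.ricci g x (B x)
        + (((m : ℝ) - 6) / 2) • AH.nabla g B x (B x)
        + (AH.divergence g B x - (((m : ℝ) - 2) / 4) * g.inner x (B x) (B x)) • B x = 0)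
    {F : Type*} [NormedAddCommGroup F] [NormedSpace ℝ F] [FiniteDimensional ℝ F]
    {N : Type*} [TopologicalSpace N] [ChartedSpace F N] [IsManifold 𝓘(ℝ, F) ∞ N]
    (h : ContMDiffRiemannianMetric 𝓘(ℝ, F) ∞ F (TangentSpace 𝓘(ℝ, F) : N → Type _))
    (J' : ∀ y : N, TangentSpace 𝓘(ℝ, F) y →L[ℝ] TangentSpace 𝓘(ℝ, F) y)
    (hN : AH.IsOneTwoSymplectic h J')
    (φ : M → N) (hφ : AH.IsHolomorphic J J' φ) :
    AH.IsBiharmonic g h φ := by 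
  refine ⟨hφ.smooth, fun x => ?_⟩
  have hx : x ∈ (extChartAt 𝓘(ℝ, E) x).source := mem_extChartAt_source x
  have hu : extChartAt 𝓘(ℝ, E) x x ∈ AH.mapDomain E F φ x :=
    ⟨mem_extChartAt_target x, by simp⟩
  have hsymm : (extChartAt 𝓘(ℝ, E) x).symm (extChartAt 𝓘(ℝ, E) x x) = x := extChartAt_to_inv x
  have hol := AH.isHolomorphicOn hlck.toIsAlmostHermitian hθ hB hN hφ x
  -- coordinate expressions at the centre of the chart
  have hg : ∀ v w : TangentSpace 𝓘(ℝ, E) x,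
      AH.locBilin x g.inner (extChartAt 𝓘(ℝ, E) x x) (AH.chartDiff x x v) (AH.chartDiff x x w) =
        g.inner x v w := fun v w => by
    rw [AH.locBilin_apply, hsymm, AH.chartFrame_chartDiff hx, AH.chartFrame_chartDiff hx]
  have hθx : ∀ v : TangentSpace 𝓘(ℝ, E) x,
      AH.locForm x θ (extChartAt 𝓘(ℝ, E) x x) (AH.chartDiff x x v) = θ x v := fun v => by
    rw [AH.locForm_apply, hsymm, AH.chartFrame_chartDiff hx]
  have hJx : ∀ v : TangentSpace 𝓘(ℝ, E) x,
      AH.locEndo x J (extChartAt 𝓘(ℝ, E) x x) (AH.chartDiff x x v) = AH.chartDiff x x (J x v) :=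
    fun v => by
      rw [AH.locEndo_apply, hsymm, AH.chartFrame_chartDiff hx]
  have hBx : AH.locVec x B (extChartAt 𝓘(ℝ, E) x x) = AH.chartDiff x x (B x) := by
    rw [AH.locVec_apply, hsymm]
  have hcov : ∀ v : TangentSpace 𝓘(ℝ, E) x,
      Coord.cov (AH.locBilin x g.inner) (AH.locVec x B) (extChartAt 𝓘(ℝ, E) x x)
        (AH.chartDiff x x v) = AH.chartDiff x x (AH.nabla g B x v) := fun v => by
    rw [AH.nabla, AH.chartDiff_chartFrame hx]
  have key := hol.bitension_eq_zero hu (m := m) (by rw [hm])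
    -- Every coordinate vector is the image of a tangent vector under the invertible `chartDiff x
    -- x`, so the pointwise hypothesis on `M` suffices.
    (fun X Y => by
      obtain ⟨v, rfl⟩ : ∃ v, AH.chartDiff x x v = X := ⟨_, AH.chartDiff_chartFrame hx X⟩
      obtain ⟨w, rfl⟩ : ∃ w, AH.chartDiff x x w = Y := ⟨_, AH.chartDiff_chartFrame hx Y⟩
      simp only [hJx, hcov, hg, hθx]
      exact h1 x v w)
    (by
      have h3 := congrArg (AH.chartDiff x x) (h2 x)
      rw [map_add, map_add, map_add, map_smul, map_smul, map_zero, ← hcov, ← hBx,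
        AH.roughLaplacian, AH.ricci, AH.chartDiff_chartFrame hx, AH.chartDiff_chartFrame hx,
        ← hBx, ← hg, ← hBx] at h3
      exact h3)
  rw [AH.bitension, key, map_zero]
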